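/- Let $\ell>0$ and $\nu(z)=e^{\ell(z+z^{-1})/2}$, $z\neq0$, so that $\nu(e^{i\theta})=e^{\ell\cos\theta}$ on the unit circle $\mathbb T$ (oriented positively). Let $\{\Phi_n\}_{n\ge0}$ be the monic orthogonal polynomials on $\mathbb T$, $\deg\Phi_n=n$, $$\int_{\mathbb T}\Phi_n(z)\overline{\Phi_m(z)}\,\frac{\nu(z)}{iz}\,dz=\kappa_n^{-2}\delta_{n,m},\qquad \kappa_n>0,$$ let $\Phi_n^*(z)=z^n\overline{\Phi_n(1/\bar z)}$ be the reciprocal polynomials, $\alpha_k=-\overline{\Phi_{k+1}(0)}$ for $k\ge-1$ (so $\alpha_{-1}=-1$) the Verblunsky coefficients, and $b_n=2\pi\kappa_n^2$. For $n\ge1$ and $z\in\mathbb C\setminus\mathbb T$ put $$G_n(z)=\frac1{2\pi i}\int_{\mathbb T}\frac{\Phi_n(t)}{t-z}\frac{\nu(t)}{t^n}\,dt,\qquad G_{n-1}^*(z)=\frac1{2\pi i}\int_{\mathbb T}\frac{\Phi_{n-1}^*(t)}{t-z}\frac{\nu(t)}{t^n}\,dt,$$ $$Y_n=\begin{bmatrix}\Phi_n&G_n\\-b_{n-1}\Phi_{n-1}^*&-b_{n-1}G_{n-1}^*\end{bmatrix},\qquad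 C_n(z)=\begin{bmatrix}z^{-n/2}\nu(z)^{1/2}&0\\0&z^{n/2}\nu(z)^{-1/2}\end{bmatrix},\qquad Z_n=Y_nC_n,\qquad M_n=Z_n'Z_n^{-1},$$ where $z^{1/2}$ and $\nu^{1/2}$ are any holomorphic branches on an open subset of $\mathbb C\setminus(\mathbb T\cup\{0\})$. Then the $\alpha_k$ are real and, for every $n\ge1$, the functions $G_n,G_{n-1}^*$ are holomorphic in $\mathbb C\setminus\mathbb T$, $\det Y_n=1$ there, and the following hold. (1) On $\mathbb C\setminus(\mathbb T\cup\{0\})$, for every choice of the branches, $z^2M_n(z)=\widetilde M_n(z)$, where $$\widetilde M_n(z)=\begin{bmatrix}\frac\ell4z^2+\frac n2z+\frac\ell4\big(\frac{b_{n-1}}{b_n}-\alpha_{n-1}^2\big)&-\frac{\ell}{2b_n}(\alpha_{n-1}-\alpha_nz)\\-\frac{\ell}{2}b_{n-1}(\alpha_{n-1}-\alpha_{n-2}z)&-\frac\ell4z^2-\frac n2z-\frac\ell4\big(\frac{b_{n-1}}{b_n}-\alpha_{n-1}^2\big)\end{bmatrix}.$$ (2) On $\mathbb C\setminus(\mathbb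 T\cup\{0\})$, $$z^2Y_n'=\widetilde M_nY_n-z^2Y_nC_n'C_n^{-1},$$ $$z^2Y_n''+2Y_n'\big(z^2C_n'C_n^{-1}+zI_2\big)+Y_n\big(z^2C_n''C_n^{-1}+2zC_n'C_n^{-1}\big)=\Big(\widetilde M_n'+\frac{\widetilde M_n^2}{z^2}\Big)Y_n.$$ (3) First-order relations (those for $\Phi_n,\Phi_{n-1}^*$ for all $z\in\mathbb C$, those for $G_n,G_{n-1}^*$ for all $z\in\mathbb C\setminus\mathbb T$): $$\begin{aligned} z^2\Phi_n'&=\big(nz+\tfrac\ell2-\tfrac\ell2\alpha_{n-1}^2\big)\Phi_n+\tfrac\ell2\tfrac{b_{n-1}}{b_n}(\alpha_{n-1}-\alpha_nz)\Phi_{n-1}^*,\\ z^2G_n'&=\big(\tfrac\ell2z^2-\tfrac\ell2\alpha_{n-1}^2\big)G_n+\tfrac\ell2\tfrac{b_{n-1}}{b_n}(\alpha_{n-1}-\alpha_nz)G_{n-1}^*,\\ z^2(\Phi_{n-1}^*)'&=\tfrac\ell2(\alpha_{n-1}-\alpha_{n-2}z)\Phi_n+\big(-\tfrac\ell2z^2+\tfrac\ell2\alpha_{n-1}^2\big)\Phi_{n-1}^*,\\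 z^2(G_{n-1}^*)'&=\tfrac\ell2(\alpha_{n-1}-\alpha_{n-2}z)G_n+\big(-nz-\tfrac\ell2+\tfrac\ell2\alpha_{n-1}^2\big)G_{n-1}^*. \end{aligned}$$ (4) Second-order relations, on the same domains, with $K_n=\frac{\ell^2}4\big((1-\alpha_{n-1}^2)\alpha_n\alpha_{n-2}-\alpha_{n-1}^2\big)$: $$\begin{aligned} z^2\Phi_n''+\big(\tfrac\ell2z^2+(2-n)z-\tfrac\ell2\big)\Phi_n'+\big(-\tfrac{\ell n}2z-\tfrac{\ell^2}4-n-K_n\big)\Phi_n&=-\tfrac\ell2(1-\alpha_{n-1}^2)\alpha_n\Phi_{n-1}^*,\\ z^2G_n''+\big(-\tfrac\ell2z^2+(n+2)z+\tfrac\ell2\big)G_n'-\big(\ell(\tfrac n2+1)z+\tfrac{\ell^2}4+K_n\big)G_n&=-\tfrac\ell2(1-\alpha_{n-1}^2)\alpha_nG_{n-1}^*,\\ z^2(\Phi_{n-1}^*)''+\big(\tfrac\ell2z^2+(2-n)z-\tfrac\ell2\big)(\Phi_{n-1}^*)'-\big(\ell(\tfrac n2-1)z+\tfrac{\ell^2}4+K_n\big)\Phi_{n-1}^*&=-\tfrac\ell2\alpha_{n-2}\Phi_n,\\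 z^2(G_{n-1}^*)''+\big(-\tfrac\ell2z^2+(n+2)z+\tfrac\ell2\big)(G_{n-1}^*)'-\big(\tfrac{\ell n}2z+\tfrac{\ell^2}4-n+K_n\big)G_{n-1}^*&=-\tfrac\ell2\alpha_{n-2}G_n. \end{aligned}$$ -/

import Mathlib

open Polynomial

noncomputable section

namespace ModifiedBessel

/-- The modified Bessel weight `ν(z) = exp (ℓ (z + 1/z) / 2)`; on the unit circle,
`ν(e^{iθ}) = e^{ℓ cos θ}`. -/
def weight (ℓ : ℝ) (z : ℂ) : ℂ :=
  Complex.exp ((ℓ : ℂ) * (z + z⁻¹) / 2)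

/-- The pairing `∫_𝕋 P(z) conj(Q(z)) ν(z) / (i z) dz`. -/
def pairing (ν : ℂ → ℂ) (P Q : ℂ[X]) : ℂ :=
  ∮ t in C(0, 1), P.eval t * (starRingEnd ℂ) (Q.eval t) * (ν t / (Complex.I * t))

/-- `Φ` is the sequence of monic orthogonal polynomials on the unit circle with respect to
`dμ(z) = ν(z) / (i z) dz`, and `κ n > 0` are the normalizing constants,
`∫ Φ_n conj(Φ_m) dμ = κ_n⁻² δ_{n,m}`. -/
structure IsMonicOPUC (ν : ℂ → ℂ) (Φ : ℕ → ℂ[X]) (κ : ℕ → ℝ) : Prop where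
  monic : ∀ n, (Φ n).Monic
  natDegree_eq : ∀ n, (Φ n).natDegree = n
  kappa_pos : ∀ n, 0 < κ n
  orthogonal : ∀ n m, pairing ν (Φ n) (Φ m) = if n = m then (((κ n) ^ 2)⁻¹ : ℂ) else 0

/-- On the unit circle, the pairing is the integral of `P conj(Q) e^{ℓ cos θ}` in the angle. -/
theorem pairing_weight (ℓ : ℝ) (P Q : ℂ[X]) :
    pairing (weight ℓ) P Q = ∫ θ in (0 : ℝ)..2 * Real.pi,
      P.eval (circleMap 0 1 θ) * (starRingEnd ℂ) (Q.eval (circleMap 0 1 θ)) *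
        (Real.exp (ℓ * Real.cos θ) : ℂ) := by
  unfold pairing circleIntegral
  refine intervalIntegral.integral_congr fun θ _ => ?_
  have h0 : circleMap 0 1 θ ≠ 0 := circleMap_ne_center one_ne_zero
  have hw : weight ℓ (circleMap 0 1 θ) = (Real.exp (ℓ * Real.cos θ) : ℂ) := by
    have : circleMap 0 1 θ + (circleMap 0 1 θ)⁻¹ = 2 * (Real.cos θ : ℂ) := by
      rw [circleMap_zero, Complex.ofReal_one, one_mul, ← Complex.exp_neg, Complex.ofReal_cos,
        Complex.two_cos, neg_mul]
    rw [weight, this, Complex.ofReal_exp]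
    congr 1
    push_cast
    ring
  simp only [deriv_circleMap, smul_eq_mul, hw]
  have hI := Complex.I_ne_zero
  field_simp

theorem pairing_integrable (ℓ : ℝ) (P Q : ℂ[X]) : IntervalIntegrable (fun θ : ℝ =>
      P.eval (circleMap 0 1 θ) * (starRingEnd ℂ) (Q.eval (circleMap 0 1 θ)) *
        (Real.exp (ℓ * Real.cos θ) : ℂ)) MeasureTheory.volume 0 (2 * Real.pi) := by
  refine Continuous.intervalIntegrable ?_ _ _
  have h1 : Continuous (fun θ : ℝ => circleMap 0 1 θ) := continuous_circleMap 0 1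
  have h2 := P.continuous.comp h1
  have h3 := Complex.continuous_conj.comp (Q.continuous.comp h1)
  exact (h2.mul h3).mul (by fun_prop)

theorem pairing_sub_left (ℓ : ℝ) (P P' Q : ℂ[X]) :
    pairing (weight ℓ) (P - P') Q = pairing (weight ℓ) P Q - pairing (weight ℓ) P' Q := by
  simp only [pairing_weight]
  rw [← intervalIntegral.integral_sub (pairing_integrable ℓ P Q) (pairing_integrable ℓ P' Q)]
  congr 1; ext θ; simp only [eval_sub]; ring

theorem pairing_C_mul_left (ℓ : ℝ) (c : ℂ) (P Q : ℂ[X]) :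
    pairing (weight ℓ) (C c * P) Q = c * pairing (weight ℓ) P Q := by
  simp only [pairing_weight]
  rw [← intervalIntegral.integral_const_mul]
  congr 1; ext θ; simp only [eval_mul, eval_C]; ring

theorem pairing_sum_left (ℓ : ℝ) {ι : Type} (s : Finset ι) (F : ι → ℂ[X]) (Q : ℂ[X]) :
    pairing (weight ℓ) (∑ i ∈ s, F i) Q = ∑ i ∈ s, pairing (weight ℓ) (F i) Q := by
  simp only [pairing_weight]
  rw [← intervalIntegral.integral_finsetSum fun i _ => pairing_integrable ℓ (F i) Q]
  congr 1; ext θ; simp only [eval_finsetSum, Finset.sum_mul]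

theorem pairing_conj (ℓ : ℝ) (P Q : ℂ[X]) :
    pairing (weight ℓ) Q P = (starRingEnd ℂ) (pairing (weight ℓ) P Q) := by
  simp only [pairing_weight, intervalIntegral]
  rw [map_sub, ← integral_conj, ← integral_conj]
  simp only [map_mul, Complex.conj_conj, Complex.conj_ofReal]
  congr 2 <;> ext θ <;> ring

theorem pairing_self_pos (ℓ : ℝ) (P : ℂ[X]) (hP : P ≠ 0) :
    ∃ r : ℝ, 0 < r ∧ pairing (weight ℓ) P P = r := by
  refine ⟨∫ θ in (0 : ℝ)..2 * Real.pi,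
    ‖P.eval (circleMap 0 1 θ)‖ ^ 2 * Real.exp (ℓ * Real.cos θ), ?_, ?_⟩
  · have hc : Continuous (fun θ : ℝ =>
        ‖P.eval (circleMap 0 1 θ)‖ ^ 2 * Real.exp (ℓ * Real.cos θ)) := by
      have h2 := P.continuous.comp (continuous_circleMap 0 1)
      exact (h2.norm.pow 2).mul (by fun_prop)
    obtain ⟨θ, hθ, hne⟩ : ∃ θ ∈ Set.Icc (0 : ℝ) (2 * Real.pi),
        P.eval (circleMap 0 1 θ) ≠ 0 := by
      by_contra! h
      apply hP
      apply Polynomial.eq_zero_of_infinite_isRoot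
      refine Set.Infinite.mono (s := (circleMap 0 1) '' Set.Ioo 0 (2 * Real.pi)) ?_ ?_
      · rintro _ ⟨θ, hθ, rfl⟩
        exact h θ (Set.Ioo_subset_Icc_self hθ)
      · refine Set.Infinite.image ?_ (Set.Ioo_infinite Real.two_pi_pos)
        refine (injOn_circleMap_of_abs_sub_le' (R := 1) (a := 0) (b := 2 * Real.pi)
          one_ne_zero (by simp)).mono Set.Ioo_subset_Ico_self
    refine intervalIntegral.integral_pos Real.two_pi_pos hc.continuousOn
      (fun x _ => by positivity) ⟨θ, hθ, by positivity⟩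
  · rw [pairing_weight, ← intervalIntegral.integral_ofReal]
    congr 1; ext θ
    rw [Complex.mul_conj, Complex.normSq_eq_norm_sq]
    push_cast; rfl

/-- Monic orthogonal polynomials for the modified Bessel weight exist. -/
theorem exists_isMonicOPUC (ℓ : ℝ) : ∃ Φ κ, IsMonicOPUC (weight ℓ) Φ κ := by
  let B := pairing (weight ℓ)
  let Φ : ℕ → ℂ[X] := fun n => Nat.strongRec (motive := fun _ => ℂ[X]) (fun n ih =>
    X ^ n - ∑ m : Fin n, C (B (X ^ n) (ih m m.2) / B (ih m m.2) (ih m m.2)) * ih m m.2) n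
  have hΦ : ∀ n, Φ n = X ^ n -
      ∑ m : Fin n, C (B (X ^ n) (Φ m) / B (Φ m) (Φ m)) * Φ m := by
    intro n
    simp only [Φ]
    conv_lhs => rw [Nat.strongRec]
  have hdeg : ∀ n, (Φ n).Monic ∧ (Φ n).natDegree = n := by
    intro n
    induction n using Nat.strong_induction_on with
    | _ n ih =>
      have hlt : (∑ m : Fin n, C (B (X ^ n) (Φ m) / B (Φ m) (Φ m)) * Φ m).degree < (n : ℕ) := by
        refine (degree_sum_le _ _).trans_lt ((Finset.sup_lt_iff (WithBot.bot_lt_coe n)).2 ?_)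
        intro m _
        rw [← smul_eq_C_mul]
        refine (degree_smul_le _ _).trans_lt ?_
        rw [degree_eq_natDegree (ih m m.2).1.ne_zero, (ih m m.2).2]
        exact WithBot.coe_lt_coe.2 m.2
      rw [hΦ n]
      have hlt' := hlt
      rw [← degree_X_pow (R := ℂ) n] at hlt'
      refine ⟨(monic_X_pow n).sub_of_left hlt', ?_⟩
      rw [natDegree_eq_of_degree_eq (degree_sub_eq_left_of_degree_lt hlt'), natDegree_X_pow]
  have hpos : ∀ n, ∃ r : ℝ, 0 < r ∧ B (Φ n) (Φ n) = r := fun n =>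
    pairing_self_pos ℓ _ (hdeg n).1.ne_zero
  choose r hr hB using hpos
  have hlt : ∀ n, ∀ m < n, B (Φ n) (Φ m) = 0 := by
    intro n
    induction n using Nat.strong_induction_on with
    | _ n ih =>
      intro m hm
      have hne : B (Φ m) (Φ m) ≠ 0 := by rw [hB]; exact_mod_cast (hr m).ne'
      rw [hΦ n]
      simp only [B, pairing_sub_left, pairing_sum_left, pairing_C_mul_left]
      rw [Finset.sum_eq_single (⟨m, hm⟩ : Fin n)]
      · exact sub_eq_zero.2 (div_mul_cancel₀ _ hne).symm
      · intro k _ hk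
        have hkm : (k : ℕ) ≠ m := fun h => hk (Fin.ext h)
        rcases lt_or_gt_of_ne hkm with h | h
        · rw [pairing_conj ℓ (Φ m) (Φ k), show pairing (weight ℓ) (Φ m) (Φ k) = 0 from ih m hm k h]; simp
        · rw [show pairing (weight ℓ) (Φ k) (Φ m) = 0 from ih k k.2 m h]; simp
      · simp
  refine ⟨Φ, fun n => (√(r n))⁻¹, fun n => (hdeg n).1, fun n => (hdeg n).2,
    fun n => by have := hr n; positivity, fun n m => ?_⟩
  split_ifs with h
  · subst h
    rw [show pairing (weight ℓ) (Φ n) (Φ n) = r n from hB n]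
    rw [← Complex.ofReal_pow, ← Complex.ofReal_inv, inv_pow, inv_inv, Real.sq_sqrt (hr n).le]
  · rcases lt_or_gt_of_ne h with h | h
    · rw [pairing_conj, show pairing (weight ℓ) (Φ m) (Φ n) = 0 from hlt m n h, map_zero]
    · exact hlt n m h

/-- The reciprocal polynomial `Φ_n^*(z) = z^n conj(Φ_n(1 / conj z))`. -/
def reciprocal (Φ : ℕ → ℂ[X]) (n : ℕ) : ℂ[X] :=
  ((Φ n).reflect n).map (starRingEnd ℂ)

/-- The Verblunsky coefficients `α_k = - conj(Φ_{k+1}(0))` for `k ≥ -1`; as `Φ_0 = 1`, this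
includes the convention `α_{-1} = -1`. -/
def verblunsky (Φ : ℕ → ℂ[X]) (k : ℤ) : ℂ :=
  -(starRingEnd ℂ) ((Φ (k + 1).toNat).eval 0)

/-- `b_n = 2 π κ_n²`. -/
def bCoeff (κ : ℕ → ℝ) (n : ℕ) : ℂ :=
  2 * (Real.pi : ℂ) * (κ n : ℂ) ^ 2

/-- `G_n(z) = (2πi)⁻¹ ∫_𝕋 Φ_n(t) / (t - z) · ν(t) / t^n dt`. -/
def G (ν : ℂ → ℂ) (Φ : ℕ → ℂ[X]) (n : ℕ) (z : ℂ) : ℂ :=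
  (2 * (Real.pi : ℂ) * Complex.I)⁻¹ *
    ∮ t in C(0, 1), (Φ n).eval t / (t - z) * (ν t / t ^ n)

/-- `G_m^*(z) = (2πi)⁻¹ ∫_𝕋 Φ_m^*(t) / (t - z) · ν(t) / t^{m+1} dt`. -/
def GStar (ν : ℂ → ℂ) (Φ : ℕ → ℂ[X]) (m : ℕ) (z : ℂ) : ℂ :=
  (2 * (Real.pi : ℂ) * Complex.I)⁻¹ *
    ∮ t in C(0, 1), (reciprocal Φ m).eval t / (t - z) * (ν t / t ^ (m + 1))

/-- The matrix `Y_n` (for `n ≥ 1`) that solves the Riemann--Hilbert problem. -/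
def Y (ν : ℂ → ℂ) (Φ : ℕ → ℂ[X]) (κ : ℕ → ℝ) (n : ℕ) (z : ℂ) : Matrix (Fin 2) (Fin 2) ℂ :=
  !![(Φ n).eval z, G ν Φ n z;
    -bCoeff κ (n - 1) * (reciprocal Φ (n - 1)).eval z, -bCoeff κ (n - 1) * GStar ν Φ (n - 1) z]

/-- `ρ` and `σ` are holomorphic branches of `z^{1/2}` and `ν(z)^{1/2}` on the open set `U`. -/
structure IsBranchPair (ν : ℂ → ℂ) (U : Set ℂ) (ρ σ : ℂ → ℂ) : Prop where
  isOpen : IsOpen U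
  diff_left : DifferentiableOn ℂ ρ U
  diff_right : DifferentiableOn ℂ σ U
  sq_left : ∀ z ∈ U, ρ z ^ 2 = z
  sq_right : ∀ z ∈ U, σ z ^ 2 = ν z

/-- `C_n(z) = diag (z^{-n/2} ν(z)^{1/2}, z^{n/2} ν(z)^{-1/2})` for the chosen branches `ρ` of
`z^{1/2}` and `σ` of `ν^{1/2}`. -/
def CMat (ρ σ : ℂ → ℂ) (n : ℕ) (z : ℂ) : Matrix (Fin 2) (Fin 2) ℂ :=
  !![σ z / ρ z ^ n, 0; 0, ρ z ^ n / σ z]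

/-- The fundamental matrix `Z_n = Y_n C_n`. -/
def Z (ν : ℂ → ℂ) (Φ : ℕ → ℂ[X]) (κ : ℕ → ℝ) (ρ σ : ℂ → ℂ) (n : ℕ) (z : ℂ) :
    Matrix (Fin 2) (Fin 2) ℂ :=
  Y ν Φ κ n z * CMat ρ σ n z

/-- The entrywise derivative of a matrix function of a complex variable. -/
def mderiv (F : ℂ → Matrix (Fin 2) (Fin 2) ℂ) (z : ℂ) : Matrix (Fin 2) (Fin 2) ℂ :=
  Matrix.of fun i j => deriv (fun w => F w i j) z

/-- The structure matrix `M_n = Z_n' Z_n⁻¹`. -/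
def M (ν : ℂ → ℂ) (Φ : ℕ → ℂ[X]) (κ : ℕ → ℝ) (ρ σ : ℂ → ℂ) (n : ℕ) (z : ℂ) :
    Matrix (Fin 2) (Fin 2) ℂ :=
  mderiv (Z ν Φ κ ρ σ n) z * (Z ν Φ κ ρ σ n z)⁻¹

/-- The explicit quadratic matrix polynomial that `z² M_n(z)` is claimed to be. -/
def MTilde (ℓ : ℝ) (Φ : ℕ → ℂ[X]) (κ : ℕ → ℝ) (n : ℕ) (z : ℂ) : Matrix (Fin 2) (Fin 2) ℂ :=
  let α : ℤ → ℂ := verblunsky Φ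
  let b : ℕ → ℂ := bCoeff κ
  !![(ℓ : ℂ) / 4 * z ^ 2 + n / 2 * z + ℓ / 4 * (b (n - 1) * (b n)⁻¹ - α (n - 1) ^ 2),
      -(ℓ : ℂ) / 2 * (b n)⁻¹ * (α (n - 1) - α n * z);
    -(ℓ : ℂ) / 2 * b (n - 1) * (α (n - 1) - α (n - 2) * z),
      -(ℓ : ℂ) / 4 * z ^ 2 - n / 2 * z - ℓ / 4 * (b (n - 1) * (b n)⁻¹ - α (n - 1) ^ 2)]

end ModifiedBessel

end

open Polynomial

noncomputable section

namespace ModifiedBessel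

/-! ### The pairing -/

/-! The weight satisfies the Pearson equation `z² ν' = (ℓ/2)(z² - 1) ν`. Every differential relation
comes from integrating this equation over the circle; no Riemann–Hilbert or Liouville argument is
used. Write `a_n = Φ_n(0)`. It is real because the weight is invariant under conjugation, so
`α_{n-1} = -a_n`.

A polynomial of degree less than `N` that is orthogonal to `1, X, …, X^(N-1)` vanishes
(`eq_zero_of_pairing_X_pow`). This gives the Szegő recursion, and with the Pearson equation the
structure relation `X_mul_derivative`, which expresses `X Φ_{n+1}'` through `Φ_{n+1}`, `Φ_n` and
`Φ_n^*`. At `0` it becomes discrete Painlevé II (`painleve`). Reflecting it gives the relation for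
`Φ_n^*`, and the Szegő recursion then eliminates `Φ_n`, leaving a closed system for `Φ_{n+1}` and
`Φ_n^*`.

For the Cauchy transforms, integrating an exact derivative on the circle moves `z² d/dz` onto the
polynomial in the density, up to one moment (`sq_mul_deriv_cauchyTransform`). Inserting the
polynomial system and pulling out powers of the variable leaves moments that cancel by
orthogonality, so `G_{n+1}` and `G_n^*` obey a companion system. The determinant of `Y` comes from
evaluating the Cauchy transform of `Φ_n^* Φ_{n+1}` in two ways (`casoratian`).

Multiplication by `C_n` adds a diagonal logarithmic derivative independent of the branches, and this
merges the two systems into one with trace-free matrix `MTilde`. Differentiating it gives the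
second-order matrix equation. The scalar second-order equations follow by elimination; Painlevé II
is what makes the resulting coefficient divisible by `z²`. -/

theorem pairing_add_left (ℓ : ℝ) (P P' Q : ℂ[X]) :
    pairing (weight ℓ) (P + P') Q = pairing (weight ℓ) P Q + pairing (weight ℓ) P' Q := by
  have h := pairing_sub_left ℓ (P + P') P' Q
  rw [add_sub_cancel_right] at h
  rw [h, sub_add_cancel]

theorem pairing_zero_left (ℓ : ℝ) (Q : ℂ[X]) : pairing (weight ℓ) 0 Q = 0 := by
  simpa using pairing_sub_left ℓ 0 0 Q

theorem pairing_sub_right (ℓ : ℝ) (P Q Q' : ℂ[X]) :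
    pairing (weight ℓ) P (Q - Q') = pairing (weight ℓ) P Q - pairing (weight ℓ) P Q' := by
  rw [pairing_conj, pairing_sub_left, map_sub, ← pairing_conj, ← pairing_conj]

theorem pairing_C_mul_right (ℓ : ℝ) (c : ℂ) (P Q : ℂ[X]) :
    pairing (weight ℓ) P (C c * Q) = (starRingEnd ℂ) c * pairing (weight ℓ) P Q := by
  rw [pairing_conj, pairing_C_mul_left, map_mul, ← pairing_conj]

theorem pairing_zero_right (ℓ : ℝ) (P : ℂ[X]) : pairing (weight ℓ) P 0 = 0 := by
  rw [pairing_conj, pairing_zero_left, map_zero]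

theorem conj_circleMap (θ : ℝ) :
    (starRingEnd ℂ) (circleMap 0 1 θ) = (circleMap 0 1 θ)⁻¹ := by
  rw [Complex.inv_def, Complex.normSq_eq_norm_sq]
  simp

/-- Multiplication by the independent variable is unitary. -/
theorem pairing_X_mul_X_mul (ℓ : ℝ) (P Q : ℂ[X]) :
    pairing (weight ℓ) (X * P) (X * Q) = pairing (weight ℓ) P Q := by
  simp only [pairing_weight]
  congr 1; ext θ
  have h0 : circleMap 0 1 θ ≠ 0 := circleMap_ne_center one_ne_zero
  simp only [eval_mul, eval_X, map_mul, conj_circleMap]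
  field_simp

theorem pairing_X_mul_X_pow_succ (ℓ : ℝ) (P : ℂ[X]) (j : ℕ) :
    pairing (weight ℓ) (X * P) (X ^ (j + 1)) = pairing (weight ℓ) P (X ^ j) := by
  rw [pow_succ', pairing_X_mul_X_mul]

/-- On the circle `1 / conj z = z`, so passing to the reciprocal polynomial is conjugation up to a
unimodular factor. `N` may exceed the degree of `P`. -/
theorem eval_map_conj_reflect {N : ℕ} {P : ℂ[X]} (hP : P.natDegree ≤ N) (θ : ℝ) :
    ((P.reflect N).map (starRingEnd ℂ)).eval (circleMap 0 1 θ) =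
      circleMap 0 1 θ ^ N * (starRingEnd ℂ) (P.eval (circleMap 0 1 θ)) := by
  have h0 : circleMap 0 1 θ ≠ 0 := circleMap_ne_center one_ne_zero
  have h1 := invertibleOfNonzero (inv_ne_zero h0)
  have h := eval₂_reflect_mul_pow (starRingEnd ℂ) (circleMap 0 1 θ)⁻¹ N P hP
  rw [invOf_eq_inv, inv_inv, ← conj_circleMap, eval₂_hom] at h
  rw [eval_map, ← h, conj_circleMap, inv_pow]
  field_simp

theorem pairing_reflect (ℓ : ℝ) {N : ℕ} {P Q : ℂ[X]} (hP : P.natDegree ≤ N)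
    (hQ : Q.natDegree ≤ N) :
    pairing (weight ℓ) ((P.reflect N).map (starRingEnd ℂ)) ((Q.reflect N).map (starRingEnd ℂ)) =
      pairing (weight ℓ) Q P := by
  simp only [pairing_weight]
  congr 1; ext θ
  have h0 : circleMap 0 1 θ ≠ 0 := circleMap_ne_center one_ne_zero
  simp only [eval_map_conj_reflect hP, eval_map_conj_reflect hQ, map_mul, map_pow,
    conj_circleMap, Complex.conj_conj, inv_pow]
  field_simp

theorem eval_map_conj (P : ℂ[X]) (z : ℂ) :
    (P.map (starRingEnd ℂ)).eval z = (starRingEnd ℂ) (P.eval ((starRingEnd ℂ) z)) := by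
  rw [eval_map, ← eval₂_hom, Complex.conj_conj]

/-- The weight is invariant under complex conjugation. -/
theorem pairing_map_conj (ℓ : ℝ) (P Q : ℂ[X]) :
    pairing (weight ℓ) (P.map (starRingEnd ℂ)) (Q.map (starRingEnd ℂ)) =
      (starRingEnd ℂ) (pairing (weight ℓ) P Q) := by
  rw [← pairing_conj]
  simp only [pairing_weight]
  have key := intervalIntegral.integral_comp_sub_left (a := 0) (b := 2 * Real.pi)
    (fun θ : ℝ => Q.eval (circleMap 0 1 θ) * (starRingEnd ℂ) (P.eval (circleMap 0 1 θ)) *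
        (Real.exp (ℓ * Real.cos θ) : ℂ)) (2 * Real.pi)
  rw [sub_self, sub_zero] at key
  rw [← key]
  congr 1; ext θ
  have h : circleMap 0 1 (2 * Real.pi - θ) = (starRingEnd ℂ) (circleMap 0 1 θ) := by
    have h2 := periodic_circleMap 0 1 (-θ)
    rw [show 2 * Real.pi - θ = -θ + 2 * Real.pi by ring, h2, conj_circleMap]
    simp [circleMap, ← Complex.exp_neg]
  simp only [eval_map_conj, h, Real.cos_two_pi_sub, Complex.conj_conj]
  ring

/-- The logarithmic derivative is rational with a double pole at `0`; this is the origin of the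
factor `z²` in all the differential relations. -/
theorem hasDerivAt_weight (ℓ : ℝ) {z : ℂ} (hz : z ≠ 0) :
    HasDerivAt (weight ℓ) (ℓ / 2 * (1 - (z ^ 2)⁻¹) * weight ℓ z) z := by
  have h := ((((hasDerivAt_id z).add (hasDerivAt_inv hz)).const_mul (ℓ : ℂ)).div_const 2).cexp
  refine h.congr_deriv ?_
  simp only [weight, id, Pi.add_apply]
  ring

/-- The Pearson equation of the weight, paired with a monomial. -/
theorem pairing_pearson (ℓ : ℝ) (P : ℂ[X]) (j : ℕ) :
    pairing (weight ℓ) (X * derivative P) (X ^ j) - j * pairing (weight ℓ) P (X ^ j) +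
      ℓ / 2 * (pairing (weight ℓ) (X * P) (X ^ j) - pairing (weight ℓ) P (X ^ (j + 1))) = 0 := by
  -- `P z^{-j} ν` is single-valued on the circle, so its derivative integrates to zero. On the
  -- circle `z^{-j}` is the conjugate of `z^j`.
  have h0 := circleIntegral.integral_eq_zero_of_hasDerivWithinAt (c := 0) (R := 1) zero_le_one
    (f := fun z => P.eval z * (z ^ j)⁻¹ * weight ℓ z)
    (f' := fun z => ((derivative P).eval z * (z ^ j)⁻¹ +
      P.eval z * (-(j * z ^ (j - 1)) / (z ^ j) ^ 2)) * weight ℓ z +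
      P.eval z * (z ^ j)⁻¹ * (ℓ / 2 * (1 - (z ^ 2)⁻¹) * weight ℓ z)) (by
    intro z hz
    have hz0 : z ≠ 0 := by
      rintro rfl; simp at hz
    exact (((P.hasDerivAt z).mul ((hasDerivAt_pow j z).inv (pow_ne_zero _ hz0))).mul
      (hasDerivAt_weight ℓ hz0)).hasDerivWithinAt)
  have hl : pairing (weight ℓ) (X * derivative P) (X ^ j) - j * pairing (weight ℓ) P (X ^ j) +
      ℓ / 2 * (pairing (weight ℓ) (X * P) (X ^ j) - pairing (weight ℓ) P (X ^ (j + 1))) =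
      pairing (weight ℓ) (X * derivative P - C (j : ℂ) * P + C (ℓ / 2 : ℂ) * (X * P)) (X ^ j) -
        pairing (weight ℓ) (C (ℓ / 2 : ℂ) * P) (X ^ (j + 1)) := by
    simp only [pairing_add_left, pairing_sub_left, pairing_C_mul_left]
    ring
  rw [hl]
  refine Eq.trans ?_ ((congrArg (Complex.I⁻¹ * ·) h0).trans (mul_zero _))
  simp only [pairing_weight]
  rw [← intervalIntegral.integral_sub (pairing_integrable ℓ _ _) (pairing_integrable ℓ _ _),
    circleIntegral, ← intervalIntegral.integral_const_mul]
  congr 1; ext θ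
  have hc : circleMap 0 1 θ ≠ 0 := circleMap_ne_center one_ne_zero
  have hw : weight ℓ (circleMap 0 1 θ) = (Real.exp (ℓ * Real.cos θ) : ℂ) := by
    have : circleMap 0 1 θ + (circleMap 0 1 θ)⁻¹ = 2 * (Real.cos θ : ℂ) := by
      rw [circleMap_zero, Complex.ofReal_one, one_mul, ← Complex.exp_neg, Complex.ofReal_cos,
        Complex.two_cos, neg_mul]
    rw [weight, this, Complex.ofReal_exp]
    congr 1
    push_cast
    ring
  simp only [deriv_circleMap, smul_eq_mul, hw, eval_mul, eval_sub, eval_add, eval_X, eval_C,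
    eval_pow, map_pow, conj_circleMap, inv_pow]
  have hI := Complex.I_ne_zero
  -- The derivative of `z ^ j` contains the truncated exponent `j - 1`, so `j = 0` is separate.
  rcases j with _ | j
  · field_simp
    simp
    ring
  · field_simp
    simp
    ring

/-- Positive definiteness: `P` lies in the span of the test monomials, so it would be orthogonal to
itself. This is how polynomial identities are verified below. -/
theorem eq_zero_of_pairing_X_pow {ℓ : ℝ} {N : ℕ} {P : ℂ[X]} (hP : P.degree < N)
    (h : ∀ j < N, pairing (weight ℓ) P (X ^ j) = 0) : P = 0 := by
  by_contra hne
  obtain ⟨r, hr, hr'⟩ := pairing_self_pos ℓ P hne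
  have h0 : pairing (weight ℓ) P P = 0 := by
    conv_lhs => arg 3; rw [P.as_sum_range' N ((natDegree_lt_iff_degree_lt hne).2 hP)]
    rw [pairing_conj, pairing_sum_left, map_sum]
    refine Finset.sum_eq_zero fun j hj => ?_
    rw [← C_mul_X_pow_eq_monomial, pairing_C_mul_left, pairing_conj, h j (Finset.mem_range.1 hj)]
    simp
  rw [h0] at hr'
  exact hr.ne (by exact_mod_cast hr')

/-! ### Orthogonal polynomials on the unit circle for the modified Bessel weight -/

namespace IsMonicOPUC

variable {ℓ : ℝ} {Φ : ℕ → ℂ[X]} {κ : ℕ → ℝ}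

theorem degree_eq (hΦ : IsMonicOPUC (weight ℓ) Φ κ) (n : ℕ) : (Φ n).degree = n := by
  rw [degree_eq_natDegree (hΦ.monic n).ne_zero, hΦ.natDegree_eq]

theorem norm_sq_ne_zero (hΦ : IsMonicOPUC (weight ℓ) Φ κ) (n : ℕ) :
    ((κ n : ℂ) ^ 2)⁻¹ ≠ 0 := by
  have := (hΦ.kappa_pos n).ne'
  exact inv_ne_zero (pow_ne_zero _ (by exact_mod_cast this))

theorem pairing_eq_zero_of_degree_lt (hΦ : IsMonicOPUC (weight ℓ) Φ κ) {n : ℕ} {Q : ℂ[X]}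
    (hQ : Q.degree < n) : pairing (weight ℓ) (Φ n) Q = 0 := by
  induction hd : Q.natDegree using Nat.strong_induction_on generalizing Q with
  | _ d ih =>
    by_cases h0 : Q = 0
    · rw [h0, pairing_zero_right]
    have hdn : d < n := by rw [← hd]; exact (natDegree_lt_iff_degree_lt h0).2 hQ
    have hdeg : Q.degree = (C Q.leadingCoeff * Φ d).degree := by
      rw [degree_C_mul (leadingCoeff_ne_zero.2 h0), hΦ.degree_eq, degree_eq_natDegree h0, hd]
    have hlt : (Q - C Q.leadingCoeff * Φ d).degree < Q.degree := by
      refine degree_sub_lt_left hdeg h0 ?_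
      rw [leadingCoeff_mul, leadingCoeff_C, (hΦ.monic d).leadingCoeff, mul_one]
    have hR : pairing (weight ℓ) (Φ n) (Q - C Q.leadingCoeff * Φ d) = 0 := by
      by_cases hR0 : Q - C Q.leadingCoeff * Φ d = 0
      · rw [hR0, pairing_zero_right]
      · exact ih _ ((natDegree_lt_natDegree hR0 hlt).trans_eq hd) (hlt.trans hQ) rfl
    rw [pairing_sub_right, pairing_C_mul_right, hΦ.orthogonal, if_neg hdn.ne'] at hR
    simpa using hR

theorem pairing_X_pow_of_lt (hΦ : IsMonicOPUC (weight ℓ) Φ κ) {n j : ℕ} (hj : j < n) :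
    pairing (weight ℓ) (Φ n) (X ^ j) = 0 :=
  hΦ.pairing_eq_zero_of_degree_lt (by rw [degree_X_pow]; exact_mod_cast hj)

theorem pairing_of_monic (hΦ : IsMonicOPUC (weight ℓ) Φ κ) {n : ℕ} {Q : ℂ[X]}
    (hQ : Q.Monic) (hn : Q.natDegree = n) :
    pairing (weight ℓ) (Φ n) Q = ((κ n : ℂ) ^ 2)⁻¹ := by
  have hd : Q.degree = (Φ n).degree := by
    rw [degree_eq_natDegree hQ.ne_zero, hn, hΦ.degree_eq]
  have hlt : (Q - Φ n).degree < n := by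
    rw [← hΦ.degree_eq n, ← hd]
    exact degree_sub_lt_left hd hQ.ne_zero (by rw [hQ.leadingCoeff, (hΦ.monic n).leadingCoeff])
  have h := hΦ.pairing_eq_zero_of_degree_lt hlt
  rw [pairing_sub_right, hΦ.orthogonal, if_pos rfl] at h
  exact sub_eq_zero.1 h

theorem pairing_X_pow_self (hΦ : IsMonicOPUC (weight ℓ) Φ κ) (n : ℕ) :
    pairing (weight ℓ) (Φ n) (X ^ n) = ((κ n : ℂ) ^ 2)⁻¹ :=
  hΦ.pairing_of_monic (monic_X_pow n) (natDegree_X_pow n)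

/-- Conjugating the coefficients preserves monicity and, by the symmetry of the weight,
orthogonality; uniqueness of the monic orthogonal polynomial then forces real coefficients. -/
theorem map_conj_eq (hΦ : IsMonicOPUC (weight ℓ) Φ κ) (n : ℕ) :
    (Φ n).map (starRingEnd ℂ) = Φ n := by
  have hd : ((Φ n).map (starRingEnd ℂ)).degree = (Φ n).degree := degree_map _ _
  refine sub_eq_zero.1 (eq_zero_of_pairing_X_pow (ℓ := ℓ) (N := n) ?_ fun j hj => ?_)
  · rw [← hΦ.degree_eq n, ← hd]
    refine degree_sub_lt_left hd ((hΦ.monic n).map _).ne_zero ?_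
    rw [((hΦ.monic n).map _).leadingCoeff, (hΦ.monic n).leadingCoeff]
  · have h := pairing_map_conj ℓ (Φ n) (X ^ j)
    rw [Polynomial.map_pow, map_X, hΦ.pairing_X_pow_of_lt hj, map_zero] at h
    rw [pairing_sub_left, h, hΦ.pairing_X_pow_of_lt hj, sub_zero]

theorem conj_eval_zero (hΦ : IsMonicOPUC (weight ℓ) Φ κ) (n : ℕ) :
    (starRingEnd ℂ) ((Φ n).eval 0) = (Φ n).eval 0 := by
  conv_rhs => rw [← hΦ.map_conj_eq n, eval_map_conj, map_zero]

theorem conj_norm_sq (x : ℝ) : (starRingEnd ℂ) ((x : ℂ) ^ 2)⁻¹ = ((x : ℂ) ^ 2)⁻¹ := by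
  simp

theorem reciprocal_eq_reflect (hΦ : IsMonicOPUC (weight ℓ) Φ κ) (n : ℕ) :
    reciprocal Φ n = (Φ n).reflect n := by
  rw [reciprocal]
  ext k
  rw [coeff_map, coeff_reflect, ← coeff_map, hΦ.map_conj_eq]

theorem degree_reciprocal_lt (hΦ : IsMonicOPUC (weight ℓ) Φ κ) (n : ℕ) :
    (reciprocal Φ n).degree < (n + 1 : ℕ) := by
  rw [hΦ.reciprocal_eq_reflect, degree_lt_iff_coeff_zero]
  intro m hm
  rw [coeff_reflect, revAt_eq_self_of_lt (by omega)]
  exact coeff_eq_zero_of_natDegree_lt (by rw [hΦ.natDegree_eq]; omega)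

theorem natDegree_reciprocal_le (hΦ : IsMonicOPUC (weight ℓ) Φ κ) (n : ℕ) :
    (reciprocal Φ n).natDegree ≤ n :=
  natDegree_le_iff_coeff_eq_zero.2 fun k hk =>
    (degree_lt_iff_coeff_zero _ _).1 (hΦ.degree_reciprocal_lt n) k hk

theorem coeff_zero_reciprocal (hΦ : IsMonicOPUC (weight ℓ) Φ κ) (n : ℕ) :
    (reciprocal Φ n).coeff 0 = 1 := by
  rw [hΦ.reciprocal_eq_reflect, coeff_reflect, revAt_le (Nat.zero_le n), Nat.sub_zero]
  simpa only [hΦ.natDegree_eq n] using (hΦ.monic n).coeff_natDegree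

/-- `X^j` is the degree-`n` reflection of `X^(n-j)`, so this is orthogonality of `Φ_n` to lower
powers, read backwards. -/
theorem pairing_reciprocal_X_pow (hΦ : IsMonicOPUC (weight ℓ) Φ κ) {n j : ℕ} (hj : j ≤ n) :
    pairing (weight ℓ) (reciprocal Φ n) (X ^ j) = if j = 0 then ((κ n : ℂ) ^ 2)⁻¹ else 0 := by
  have hX : (X ^ j : ℂ[X]) = ((X ^ (n - j) : ℂ[X]).reflect n).map (starRingEnd ℂ) := by
    rw [reflect_monomial, revAt_le (Nat.sub_le n j), Polynomial.map_pow, map_X,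
      Nat.sub_sub_self hj]
  rw [hX, reciprocal, pairing_reflect ℓ (hΦ.natDegree_eq n).le
    ((natDegree_X_pow _).le.trans (Nat.sub_le n j)), pairing_conj]
  split_ifs with h
  · rw [h, Nat.sub_zero, hΦ.pairing_X_pow_self, conj_norm_sq]
  · rw [hΦ.pairing_X_pow_of_lt (by omega), map_zero]

/-- The Szegő recursion. -/
theorem szego (hΦ : IsMonicOPUC (weight ℓ) Φ κ) (n : ℕ) :
    Φ (n + 1) = X * Φ n + C ((Φ (n + 1)).eval 0) * reciprocal Φ n := by
  set a := (Φ (n + 1)).eval 0 with ha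
  set E := Φ (n + 1) - X * Φ n - C a * reciprocal Φ n with hE
  have hXd : (Φ (n + 1)).degree = (X * Φ n).degree := by
    rw [mul_comm, degree_mul_X, hΦ.degree_eq, hΦ.degree_eq]; norm_cast
  have hdeg : E.degree < (n + 1 : ℕ) := by
    refine (degree_sub_le _ _).trans_lt (max_lt ?_ ?_)
    · rw [← hΦ.degree_eq (n + 1)]
      refine degree_sub_lt_left hXd (hΦ.monic _).ne_zero ?_
      rw [(hΦ.monic _).leadingCoeff, (monic_X.mul (hΦ.monic n)).leadingCoeff]
    · rw [← smul_eq_C_mul]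
      exact (degree_smul_le _ _).trans_lt (hΦ.degree_reciprocal_lt n)
  have h0 : E.coeff 0 = 0 := by
    rw [hE, coeff_sub, coeff_sub, coeff_C_mul, mul_coeff_zero, coeff_X_zero,
      hΦ.coeff_zero_reciprocal, ha, coeff_zero_eq_eval_zero]
    ring
  -- The constant term of the defect vanishes, so it may be divided by `X`. The quotient has degree
  -- less than `n`, and unitarity of multiplication by `X` transfers the orthogonality.
  have hXE : X * E.divX = E := by
    conv_rhs => rw [← E.X_mul_divX_add, h0, C_0, add_zero]
  have hz : E.divX = 0 := by
    refine eq_zero_of_pairing_X_pow (ℓ := ℓ) (N := n) ?_ fun j hj => ?_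
    · rw [degree_lt_iff_coeff_zero] at hdeg ⊢
      intro m hm
      rw [coeff_divX]
      exact hdeg _ (by omega)
    · rw [← pairing_X_mul_X_pow_succ, hXE, hE, pairing_sub_left, pairing_sub_left,
        pairing_C_mul_left, pairing_X_mul_X_pow_succ, hΦ.pairing_X_pow_of_lt (by omega),
        hΦ.pairing_X_pow_of_lt hj, hΦ.pairing_reciprocal_X_pow (by omega)]
      simp
  rw [hz, mul_zero] at hXE
  rw [← sub_eq_zero, ← sub_sub]
  exact hXE.symm

theorem reflect_succ (hΦ : IsMonicOPUC (weight ℓ) Φ κ) (n : ℕ) :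
    reflect (n + 1) (Φ n) = X * reciprocal Φ n := by
  have h := reflect_mul (1 : ℂ[X]) (Φ n) (F := 1) (by simp) (hΦ.natDegree_eq n).le
  have h' : reflect 1 (1 : ℂ[X]) = X := by simp [reflect_one]
  rw [one_mul, add_comm 1 n, h'] at h
  rw [h, hΦ.reciprocal_eq_reflect]

theorem reflect_succ_reciprocal (hΦ : IsMonicOPUC (weight ℓ) Φ κ) (n : ℕ) :
    reflect (n + 1) (reciprocal Φ n) = X * Φ n := by
  have h := reflect_mul (1 : ℂ[X]) (reciprocal Φ n) (F := 1) (G := n) (by simp)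
    (hΦ.natDegree_reciprocal_le n)
  have h' : reflect 1 (1 : ℂ[X]) = X := by simp [reflect_one]
  rw [one_mul, add_comm 1 n, h'] at h
  rw [h, hΦ.reciprocal_eq_reflect]
  congr 1
  ext k
  rw [coeff_reflect, coeff_reflect, revAt_invol]

/-- The Szegő recursion for the reciprocal polynomials. -/
theorem szego_reciprocal (hΦ : IsMonicOPUC (weight ℓ) Φ κ) (n : ℕ) :
    reciprocal Φ (n + 1) = reciprocal Φ n + C ((Φ (n + 1)).eval 0) * (X * Φ n) := by
  have h1 : reflect (n + 1) (X * Φ n) = reciprocal Φ n := by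
    rw [add_comm n 1, reflect_mul X (Φ n) natDegree_X_le (hΦ.natDegree_eq n).le,
      hΦ.reciprocal_eq_reflect]
    rw [reflect_one_X, one_mul]
  conv_lhs => rw [hΦ.reciprocal_eq_reflect, hΦ.szego n, reflect_add, reflect_C_mul,
    h1, hΦ.reflect_succ_reciprocal]

/-- Both Szegő recursions are paired with `X^(n+1)`. The moment of `Φ_n^*` against `X^(n+1)`, not
known from orthogonality, is eliminated between them. -/
theorem norm_sq_succ (hΦ : IsMonicOPUC (weight ℓ) Φ κ) (n : ℕ) :
    ((κ (n + 1) : ℂ) ^ 2)⁻¹ = (1 - (Φ (n + 1)).eval 0 ^ 2) * ((κ n : ℂ) ^ 2)⁻¹ := by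
  have h := hΦ.pairing_X_pow_self (n + 1)
  have h' := hΦ.pairing_reciprocal_X_pow (n := n + 1) le_rfl
  rw [hΦ.szego_reciprocal, pairing_add_left, pairing_C_mul_left, pairing_X_mul_X_pow_succ,
    hΦ.pairing_X_pow_self, if_neg n.succ_ne_zero] at h'
  conv_lhs at h => rw [hΦ.szego, pairing_add_left, pairing_C_mul_left, pairing_X_mul_X_pow_succ,
    hΦ.pairing_X_pow_self]
  linear_combination (Φ (n + 1)).eval 0 * h' - h

/-- The structure relation. -/
theorem X_mul_derivative (hΦ : IsMonicOPUC (weight ℓ) Φ κ) (n : ℕ) :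
    X * derivative (Φ (n + 1)) = C (n + 1 : ℂ) * Φ (n + 1) +
      C (ℓ / 2 * (1 - (Φ (n + 1)).eval 0 ^ 2)) *
        (Φ n + C ((Φ (n + 2)).eval 0) * reciprocal Φ n) := by
  refine sub_eq_zero.1 (eq_zero_of_pairing_X_pow (ℓ := ℓ) (N := n + 1) ?_ fun j hj => ?_)
  · rw [← sub_sub]
    refine (degree_sub_le _ _).trans_lt (max_lt ?_ ?_)
    · rw [degree_lt_iff_coeff_zero]
      intro m hm
      -- In degree `n + 1` the factor `n + 1` produced by differentiation cancels the subtracted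
      -- multiple of `Φ (n + 1)`.
      rcases hm.eq_or_lt with rfl | hm
      · rw [coeff_sub, coeff_X_mul, coeff_derivative, coeff_C_mul]
        ring
      · obtain ⟨m, rfl⟩ : ∃ k, m = k + 1 := ⟨m - 1, by omega⟩
        rw [coeff_sub, coeff_X_mul, coeff_derivative, coeff_C_mul,
          coeff_eq_zero_of_natDegree_lt (by rw [hΦ.natDegree_eq]; omega)]
        ring
    · rw [← smul_eq_C_mul, ← smul_eq_C_mul]
      refine (degree_smul_le _ _).trans_lt ((degree_add_le _ _).trans_lt (max_lt ?_ ?_))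
      · rw [hΦ.degree_eq]; exact_mod_cast n.lt_succ_self
      · exact (degree_smul_le _ _).trans_lt (hΦ.degree_reciprocal_lt n)
  · have hp := pairing_pearson ℓ (Φ (n + 1)) j
    have hX : pairing (weight ℓ) (X * Φ (n + 1)) (X ^ j) =
        -((Φ (n + 2)).eval 0 * if j = 0 then ((κ (n + 1) : ℂ) ^ 2)⁻¹ else 0) := by
      rw [eq_sub_of_add_eq (hΦ.szego (n + 1)).symm, pairing_sub_left, pairing_C_mul_left,
        hΦ.pairing_X_pow_of_lt (by omega), hΦ.pairing_reciprocal_X_pow (by omega), zero_sub]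
    have h1 : pairing (weight ℓ) (Φ (n + 1)) (X ^ (j + 1)) =
        if j = n then ((κ (n + 1) : ℂ) ^ 2)⁻¹ else 0 := by
      split_ifs with h
      · rw [h, hΦ.pairing_X_pow_self]
      · exact hΦ.pairing_X_pow_of_lt (by omega)
    have h2 : pairing (weight ℓ) (Φ n) (X ^ j) = if j = n then ((κ n : ℂ) ^ 2)⁻¹ else 0 := by
      split_ifs with h
      · rw [h, hΦ.pairing_X_pow_self]
      · exact hΦ.pairing_X_pow_of_lt (by omega)
    rw [hX, h1, hΦ.pairing_X_pow_of_lt hj] at hp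
    simp only [pairing_sub_left, pairing_add_left, pairing_C_mul_left, h2,
      hΦ.pairing_X_pow_of_lt hj, hΦ.pairing_reciprocal_X_pow (show j ≤ n by omega)]
    have hs := hΦ.norm_sq_succ n
    -- Only `j = 0` and `j = n` contribute, and they coincide when `n = 0`. The norm recursion `hs`
    -- converts `κ_{n+1}` to `κ_n`.
    split_ifs at hp ⊢
    · linear_combination hp + ℓ / 2 * (1 + (Φ (n + 2)).eval 0) * hs
    · linear_combination hp + ℓ / 2 * hs
    · linear_combination hp + ℓ / 2 * (Φ (n + 2)).eval 0 * hs
    · linear_combination hp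

/-- The discrete Painlevé II equation. -/
theorem painleve (hΦ : IsMonicOPUC (weight ℓ) Φ κ) (n : ℕ) :
    (n + 1 : ℂ) * (Φ (n + 1)).eval 0 + ℓ / 2 * (1 - (Φ (n + 1)).eval 0 ^ 2) *
      ((Φ n).eval 0 + (Φ (n + 2)).eval 0) = 0 := by
  have h := congrArg (eval 0) (hΦ.X_mul_derivative n)
  simp only [eval_mul, eval_X, eval_add, eval_C, zero_mul] at h
  rw [← coeff_zero_eq_eval_zero (reciprocal Φ n), hΦ.coeff_zero_reciprocal] at h
  linear_combination -h

theorem eq_one (hΦ : IsMonicOPUC (weight ℓ) Φ κ) : Φ 0 = 1 :=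
  (hΦ.monic 0).natDegree_eq_zero.1 (hΦ.natDegree_eq 0)

theorem reciprocal_zero (hΦ : IsMonicOPUC (weight ℓ) Φ κ) : reciprocal Φ 0 = 1 := by
  rw [hΦ.reciprocal_eq_reflect, hΦ.eq_one]
  simp [reflect_one]

/-- Reflection turns the Euler operator `X d/dX` into `n - X d/dX`, so this is the mirror image of
the structure relation. The term `n Φ_n` there cancels the shift, and the Szegő recursions match
both sides. -/
theorem X_mul_derivative_reciprocal (hΦ : IsMonicOPUC (weight ℓ) Φ κ) (n : ℕ) :
    X * derivative (reciprocal Φ n) = C (ℓ / 2 : ℂ) *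
      ((C ((Φ n).eval 0) * X - C ((Φ (n + 1)).eval 0)) * Φ n +
        (C ((Φ n).eval 0 * (Φ (n + 1)).eval 0) - X) * reciprocal Φ n) := by
  rcases n with _ | n
  · rw [hΦ.reciprocal_zero, hΦ.eq_one]
    simp
  have hd : X * derivative (reciprocal Φ (n + 1)) =
      reflect (n + 1) (C (n + 1 : ℂ) * Φ (n + 1) - X * derivative (Φ (n + 1))) := by
    have hX (P : ℂ[X]) (k : ℕ) : (X * derivative P).coeff k = k * P.coeff k := by
      rcases k with _ | k
      · simp
      · rw [coeff_X_mul, coeff_derivative]; push_cast; ring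
    rw [hΦ.reciprocal_eq_reflect]
    ext k
    rw [coeff_reflect, coeff_sub, coeff_C_mul, hX, hX, coeff_reflect]
    rcases le_or_gt k (n + 1) with hk | hk
    · rw [revAt_le hk, Nat.cast_sub hk]
      push_cast; ring
    · rw [revAt_eq_self_of_lt hk, coeff_eq_zero_of_natDegree_lt (by rwa [hΦ.natDegree_eq])]
      ring
  rw [hd, hΦ.X_mul_derivative, sub_add_cancel_left, reflect_neg, reflect_C_mul, reflect_add,
    reflect_C_mul, hΦ.reflect_succ, hΦ.reflect_succ_reciprocal, hΦ.szego_reciprocal n]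
  conv_rhs => enter [2, 1, 2]; rw [hΦ.szego n]
  simp only [C_mul, C_sub, C_pow, C_1]
  ring

end IsMonicOPUC

/-! ### Cauchy transforms over the unit circle -/

/-- The Cauchy integral `(2πi)⁻¹ ∫_𝕋 P(t) / (t - z) · ν(t) / t^n dt`. -/
def cauchyTransform (ℓ : ℝ) (n : ℕ) (P : ℂ[X]) (z : ℂ) : ℂ :=
  (2 * (Real.pi : ℂ) * Complex.I)⁻¹ *
    ∮ t in C(0, 1), P.eval t / (t - z) * (weight ℓ t / t ^ n)

theorem ne_zero_of_mem_sphere {t : ℂ} (ht : t ∈ Metric.sphere (0 : ℂ) 1) : t ≠ 0 := by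
  rintro rfl
  simp at ht

theorem sub_ne_zero_of_mem_sphere {t z : ℂ} (ht : t ∈ Metric.sphere (0 : ℂ) 1)
    (hz : z ∉ Metric.sphere (0 : ℂ) 1) : t - z ≠ 0 :=
  sub_ne_zero.2 fun h => hz (h ▸ ht)

/-- A Cauchy integral may be differentiated under the integral sign off the circle. -/
theorem hasDerivAt_circleIntegral_div_sub {f : ℂ → ℂ} (hf : ContinuousOn f (Metric.sphere 0 1))
    {z : ℂ} (hz : z ∉ Metric.sphere (0 : ℂ) 1) :
    HasDerivAt (fun w => ∮ t in C(0, 1), f t / (t - w)) (∮ t in C(0, 1), f t / (t - z) ^ 2) z := by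
  obtain ⟨ε, hε, hball⟩ := Metric.isOpen_iff.1
    (Metric.isClosed_sphere (x := (0 : ℂ)) (ε := 1)).isOpen_compl z hz
  have hmem (θ : ℝ) : circleMap 0 1 θ ∈ Metric.sphere (0 : ℂ) 1 :=
    circleMap_mem_sphere 0 zero_le_one θ
  have hfc : Continuous fun θ => f (circleMap 0 1 θ) :=
    hf.comp_continuous (continuous_circleMap 0 1) hmem
  have hne {w : ℂ} (hw : w ∈ Metric.ball z (ε / 2)) (θ : ℝ) : circleMap 0 1 θ - w ≠ 0 :=
    sub_ne_zero_of_mem_sphere (hmem θ) (hball (Metric.ball_subset_ball (by linarith) hw))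
  -- The `ε`-ball about `z` misses the circle, so half its radius leaves a uniform distance `ε / 2`;
  -- this supplies the dominating function.
  have hlow {w : ℂ} (hw : w ∈ Metric.ball z (ε / 2)) (θ : ℝ) :
      ε / 2 ≤ ‖circleMap 0 1 θ - w‖ := by
    by_contra! h
    refine hball (a := circleMap 0 1 θ) ?_ (hmem θ)
    rw [Metric.mem_ball] at hw ⊢
    rw [← dist_eq_norm] at h
    linarith [dist_triangle (circleMap 0 1 θ) w z]
  have hdc : Continuous fun θ => deriv (circleMap 0 1) θ := by
    simp only [deriv_circleMap]; fun_prop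
  have hz' : z ∈ Metric.ball z (ε / 2) := Metric.mem_ball_self (by positivity)
  have hcont {w : ℂ} (hw : w ∈ Metric.ball z (ε / 2)) :
      Continuous fun θ => deriv (circleMap 0 1) θ • (f (circleMap 0 1 θ) / (circleMap 0 1 θ - w)) :=
    hdc.smul (hfc.div ((continuous_circleMap 0 1).sub continuous_const) (hne hw))
  refine (intervalIntegral.hasDerivAt_integral_of_dominated_loc_of_deriv_le
    (bound := fun θ => ‖f (circleMap 0 1 θ)‖ / (ε / 2) ^ 2)
    (F := fun w θ => deriv (circleMap 0 1) θ • (f (circleMap 0 1 θ) / (circleMap 0 1 θ - w)))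
    (F' := fun w θ =>
      deriv (circleMap 0 1) θ • (f (circleMap 0 1 θ) / (circleMap 0 1 θ - w) ^ 2))
    (Metric.ball_mem_nhds z (half_pos hε)) ?_ ?_ ?_ ?_ ?_ ?_).2
  · filter_upwards [Metric.ball_mem_nhds z (half_pos hε)] with w hw
    exact (hcont hw).aestronglyMeasurable
  · exact (hcont hz').intervalIntegrable _ _
  · exact (hdc.smul (hfc.div (((continuous_circleMap 0 1).sub continuous_const).pow 2)
      fun θ => pow_ne_zero 2 (hne hz' θ))).aestronglyMeasurable
  · refine Filter.Eventually.of_forall fun θ _ w hw => ?_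
    have h1 : ‖deriv (circleMap 0 1) θ‖ = 1 := by simp [deriv_circleMap]
    rw [norm_smul, h1, one_mul, norm_div, norm_pow]
    have := hlow hw θ
    gcongr
  · exact (hfc.norm.div_const _).intervalIntegrable _ _
  · refine Filter.Eventually.of_forall fun θ _ w hw => ?_
    have h := ((hasDerivAt_const w (f (circleMap 0 1 θ))).div
      ((hasDerivAt_const w (circleMap 0 1 θ)).sub (hasDerivAt_id w)) (hne hw θ)).const_smul
        (deriv (circleMap 0 1) θ)
    refine h.congr_deriv ?_
    simp

theorem continuousOn_density (ℓ : ℝ) (n : ℕ) (P : ℂ[X]) :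
    ContinuousOn (fun t => P.eval t * (weight ℓ t / t ^ n)) (Metric.sphere 0 1) := by
  intro t ht
  have h0 := ne_zero_of_mem_sphere ht
  exact (P.continuous.continuousAt.mul ((hasDerivAt_weight ℓ h0).continuousAt.div
    (continuousAt_id.pow n) (pow_ne_zero n h0))).continuousWithinAt

theorem circleIntegrable_cauchy (ℓ : ℝ) (n : ℕ) (P : ℂ[X]) {z : ℂ}
    (hz : z ∉ Metric.sphere (0 : ℂ) 1) :
    CircleIntegrable (fun t => P.eval t / (t - z) * (weight ℓ t / t ^ n)) 0 1 := by
  refine ContinuousOn.circleIntegrable zero_le_one ?_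
  refine ((continuousOn_density ℓ n P).div (continuousOn_id.sub continuousOn_const)
    fun t ht => sub_ne_zero_of_mem_sphere ht hz).congr fun t _ => ?_
  exact div_mul_eq_mul_div _ _ _

theorem circleIntegrable_density (ℓ : ℝ) (n : ℕ) (P : ℂ[X]) :
    CircleIntegrable (fun t => P.eval t * (weight ℓ t / t ^ n)) 0 1 :=
  ContinuousOn.circleIntegrable zero_le_one (continuousOn_density ℓ n P)

theorem hasDerivAt_cauchyTransform (ℓ : ℝ) (n : ℕ) (P : ℂ[X]) {z : ℂ}
    (hz : z ∉ Metric.sphere (0 : ℂ) 1) :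
    HasDerivAt (cauchyTransform ℓ n P) ((2 * (Real.pi : ℂ) * Complex.I)⁻¹ *
      ∮ t in C(0, 1), P.eval t * (weight ℓ t / t ^ n) / (t - z) ^ 2) z := by
  have h := (hasDerivAt_circleIntegral_div_sub (continuousOn_density ℓ n P) hz).const_mul
    (2 * (Real.pi : ℂ) * Complex.I)⁻¹
  refine h.congr_of_eventuallyEq (Filter.Eventually.of_forall fun w => ?_)
  simp only [cauchyTransform, div_mul_eq_mul_div]

theorem differentiableOn_cauchyTransform (ℓ : ℝ) (n : ℕ) (P : ℂ[X]) :
    DifferentiableOn ℂ (cauchyTransform ℓ n P) (Metric.sphere 0 1)ᶜ := fun _ hz =>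
  (hasDerivAt_cauchyTransform ℓ n P hz).differentiableAt.differentiableWithinAt

theorem cauchyTransform_add (ℓ : ℝ) (n : ℕ) (P Q : ℂ[X]) {z : ℂ}
    (hz : z ∉ Metric.sphere (0 : ℂ) 1) :
    cauchyTransform ℓ n (P + Q) z = cauchyTransform ℓ n P z + cauchyTransform ℓ n Q z := by
  simp only [cauchyTransform]
  rw [← mul_add, ← circleIntegral.integral_add (circleIntegrable_cauchy ℓ n P hz)
    (circleIntegrable_cauchy ℓ n Q hz)]
  simp only [eval_add, add_div, add_mul]

theorem cauchyTransform_C_mul (ℓ : ℝ) (n : ℕ) (c : ℂ) (P : ℂ[X]) (z : ℂ) :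
    cauchyTransform ℓ n (C c * P) z = c * cauchyTransform ℓ n P z := by
  simp only [cauchyTransform]
  rw [mul_left_comm c]
  congr 1
  rw [← circleIntegral.integral_const_mul]
  refine circleIntegral.integral_congr zero_le_one fun t _ => ?_
  simp only [eval_mul, eval_C]
  ring

/-- One of the `n + 1` powers of `t` belongs to the measure `dt / (i t)`; the other `n` form the
conjugate of `t^n`. -/
theorem circleIntegral_density (ℓ : ℝ) (n : ℕ) (P : ℂ[X]) :
    (2 * (Real.pi : ℂ) * Complex.I)⁻¹ * ∮ t in C(0, 1), P.eval t * (weight ℓ t / t ^ (n + 1)) =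
      (2 * (Real.pi : ℂ))⁻¹ * pairing (weight ℓ) P (X ^ n) := by
  rw [mul_inv, mul_assoc, ← circleIntegral.integral_const_mul, pairing]
  congr 1
  refine circleIntegral.integral_congr zero_le_one fun t ht => ?_
  have h0 := ne_zero_of_mem_sphere ht
  have hc : (starRingEnd ℂ) t = t⁻¹ := by
    rw [Complex.inv_def, Complex.normSq_eq_norm_sq, mem_sphere_zero_iff_norm.1 ht]
    simp
  have hI := Complex.I_ne_zero
  simp only [eval_pow, eval_X, map_pow, hc, inv_pow]
  field_simp
  ring

theorem cauchyTransform_X_sub_C_mul (ℓ : ℝ) (n : ℕ) (P : ℂ[X]) {z : ℂ}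
    (hz : z ∉ Metric.sphere (0 : ℂ) 1) :
    cauchyTransform ℓ (n + 1) ((X - C z) * P) z =
      (2 * (Real.pi : ℂ))⁻¹ * pairing (weight ℓ) P (X ^ n) := by
  rw [← circleIntegral_density, cauchyTransform]
  congr 1
  refine circleIntegral.integral_congr zero_le_one fun t ht => ?_
  have h := sub_ne_zero_of_mem_sphere ht hz
  simp only [eval_mul, eval_sub, eval_X, eval_C]
  field_simp

theorem cauchyTransform_X_mul (ℓ : ℝ) (n : ℕ) (P : ℂ[X]) {z : ℂ}
    (hz : z ∉ Metric.sphere (0 : ℂ) 1) :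
    cauchyTransform ℓ (n + 1) (X * P) z = z * cauchyTransform ℓ (n + 1) P z +
      (2 * (Real.pi : ℂ))⁻¹ * pairing (weight ℓ) P (X ^ n) := by
  rw [← cauchyTransform_X_sub_C_mul ℓ n P hz, ← cauchyTransform_C_mul,
    ← cauchyTransform_add _ _ _ _ hz]
  congr 1
  ring

/-- The derivative of a Cauchy transform, by the Pearson equation of the weight. -/
theorem sq_mul_deriv_cauchyTransform (ℓ : ℝ) (n : ℕ) (P : ℂ[X]) {z : ℂ}
    (hz : z ∉ Metric.sphere (0 : ℂ) 1) :
    z ^ 2 * deriv (cauchyTransform ℓ (n + 1) P) z =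
      cauchyTransform ℓ (n + 1) (X ^ 2 * derivative P - C (n + 1 : ℂ) * (X * P) +
        C (ℓ / 2 : ℂ) * ((X ^ 2 - 1) * P)) z +
      (2 * (Real.pi : ℂ))⁻¹ * pairing (weight ℓ) P (X ^ n) := by
  set Q := X ^ 2 * derivative P - C (n + 1 : ℂ) * (X * P) + C (ℓ / 2 : ℂ) * ((X ^ 2 - 1) * P)
    with hQ
  set f : ℂ → ℂ := fun t => P.eval t * (weight ℓ t / t ^ (n + 1)) with hf
  have hd {t : ℂ} (ht : t ≠ 0) :
      HasDerivAt f (Q.eval t * (weight ℓ t / t ^ (n + 1)) / t ^ 2) t := by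
    refine ((P.hasDerivAt t).mul ((hasDerivAt_weight ℓ ht).div (hasDerivAt_pow (n + 1) t)
      (pow_ne_zero _ ht))).congr_deriv ?_
    simp only [hQ, eval_add, eval_sub, eval_mul, eval_pow, eval_X, eval_C, eval_one,
      Nat.add_sub_cancel, Pi.div_apply]
    push_cast
    field_simp
    ring
  -- The choice of `t² f / (t - z)` works because `d/dt (t² / (t - z)) = 1 - z² / (t - z)²`. The
  -- three integrals are therefore the transform of `Q`, a moment, and `z²` times the derivative of
  -- the transform.
  have h0 := circleIntegral.integral_eq_zero_of_hasDerivWithinAt (c := 0) (R := 1) zero_le_one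
    (f := fun t => t ^ 2 * f t / (t - z))
    (f' := fun t => Q.eval t / (t - z) * (weight ℓ t / t ^ (n + 1)) + f t -
      z ^ 2 * (f t / (t - z) ^ 2)) (by
    intro t ht
    have h0 := ne_zero_of_mem_sphere ht
    have h1 := sub_ne_zero_of_mem_sphere ht hz
    refine HasDerivAt.hasDerivWithinAt (((((hasDerivAt_pow 2 t).mul (hd h0)).div
      ((hasDerivAt_id t).sub_const z) h1)).congr_deriv ?_)
    simp only [id, Pi.mul_apply]
    generalize f t = y
    field_simp
    ring)
  have hi1 := circleIntegrable_cauchy ℓ (n + 1) Q hz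
  have hi2 := circleIntegrable_density ℓ (n + 1) P
  have hi3 : CircleIntegrable (fun t => z ^ 2 * (f t / (t - z) ^ 2)) 0 1 :=
    ContinuousOn.circleIntegrable zero_le_one (continuousOn_const.mul
      ((continuousOn_density ℓ (n + 1) P).div ((continuousOn_id.sub continuousOn_const).pow 2)
        fun t ht => pow_ne_zero 2 (sub_ne_zero_of_mem_sphere ht hz)))
  rw [circleIntegral.integral_sub (hi1.fun_add hi2) hi3, circleIntegral.integral_add hi1 hi2,
    circleIntegral.integral_const_mul] at h0
  rw [(hasDerivAt_cauchyTransform ℓ (n + 1) P hz).deriv, ← circleIntegral_density, cauchyTransform]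
  linear_combination -(2 * (Real.pi : ℂ) * Complex.I)⁻¹ * h0

/-- `Q(t) - Q(z)` is divisible by `t - z`, which cancels the Cauchy kernel and leaves a moment of
the quotient times `P`. -/
theorem cauchyTransform_mul (ℓ : ℝ) (n : ℕ) (P Q : ℂ[X]) {z : ℂ}
    (hz : z ∉ Metric.sphere (0 : ℂ) 1) :
    cauchyTransform ℓ (n + 1) (Q * P) z = Q.eval z * cauchyTransform ℓ (n + 1) P z +
      (2 * (Real.pi : ℂ))⁻¹ * pairing (weight ℓ) (Q /ₘ (X - C z) * P) (X ^ n) := by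
  rw [← cauchyTransform_X_sub_C_mul ℓ n _ hz, ← cauchyTransform_C_mul,
    ← cauchyTransform_add _ _ _ _ hz]
  congr 1
  conv_lhs => rw [← modByMonic_add_div Q (X - C z), modByMonic_X_sub_C_eq_C_eval]
  ring

theorem pairing_mul_X_pow (ℓ : ℝ) {n : ℕ} {Q : ℂ[X]} (hQ : Q.natDegree ≤ n) (P : ℂ[X]) :
    pairing (weight ℓ) (Q * P) (X ^ n) =
      pairing (weight ℓ) P ((Q.reflect n).map (starRingEnd ℂ)) := by
  simp only [pairing_weight]
  congr 1; ext θ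
  simp only [eval_map_conj_reflect hQ, eval_mul, eval_pow, eval_X, map_mul, Complex.conj_conj]
  ring

namespace IsMonicOPUC

variable {ℓ : ℝ} {Φ : ℕ → ℂ[X]} {κ : ℕ → ℝ}

/-! ### First order relations -/

/-- After one more factor `X`, the Szegő recursion trades `X Φ_n` for `Φ_{n+1}` and `Φ_n^*`, the
polynomials in the first column of `Y`. -/
theorem sq_mul_derivative (hΦ : IsMonicOPUC (weight ℓ) Φ κ) (n : ℕ) :
    X ^ 2 * derivative (Φ (n + 1)) =
      (C (n + 1 : ℂ) * X + C (ℓ / 2 * (1 - (Φ (n + 1)).eval 0 ^ 2))) * Φ (n + 1) +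
        C (ℓ / 2 * (1 - (Φ (n + 1)).eval 0 ^ 2)) *
          (C ((Φ (n + 2)).eval 0) * X - C ((Φ (n + 1)).eval 0)) * reciprocal Φ n := by
  have h := hΦ.X_mul_derivative n
  have hs := hΦ.szego n
  linear_combination X * h - C (ℓ / 2 * (1 - (Φ (n + 1)).eval 0 ^ 2)) * hs

theorem sq_mul_derivative_reciprocal (hΦ : IsMonicOPUC (weight ℓ) Φ κ) (n : ℕ) :
    X ^ 2 * derivative (reciprocal Φ n) =
      C (ℓ / 2 : ℂ) * (C ((Φ n).eval 0) * X - C ((Φ (n + 1)).eval 0)) * Φ (n + 1) +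
        C (ℓ / 2 : ℂ) * (C ((Φ (n + 1)).eval 0 ^ 2) - X ^ 2) * reciprocal Φ n := by
  have h := hΦ.X_mul_derivative_reciprocal n
  have hs := hΦ.szego n
  rw [C_mul] at h
  rw [C_pow]
  linear_combination X * h -
    C (ℓ / 2 : ℂ) * (C ((Φ n).eval 0) * X - C ((Φ (n + 1)).eval 0)) * hs

theorem sq_mul_deriv_G (hΦ : IsMonicOPUC (weight ℓ) Φ κ) (n : ℕ) {z : ℂ}
    (hz : z ∉ Metric.sphere (0 : ℂ) 1) :
    z ^ 2 * deriv (G (weight ℓ) Φ (n + 1)) z =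
      (ℓ / 2 * z ^ 2 - ℓ / 2 * (Φ (n + 1)).eval 0 ^ 2) * G (weight ℓ) Φ (n + 1) z +
        ℓ / 2 * (1 - (Φ (n + 1)).eval 0 ^ 2) * ((Φ (n + 2)).eval 0 * z - (Φ (n + 1)).eval 0) *
          GStar (weight ℓ) Φ n z := by
  change z ^ 2 * deriv (cauchyTransform ℓ (n + 1) (Φ (n + 1))) z =
    _ * cauchyTransform ℓ (n + 1) (Φ (n + 1)) z +
      _ * cauchyTransform ℓ (n + 1) (reciprocal Φ n) z
  have hQ : X ^ 2 * derivative (Φ (n + 1)) - C (n + 1 : ℂ) * (X * Φ (n + 1)) +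
        C (ℓ / 2 : ℂ) * ((X ^ 2 - 1) * Φ (n + 1)) =
      C (ℓ / 2 : ℂ) * (X * (X * Φ (n + 1))) +
        C (-(ℓ / 2 * (Φ (n + 1)).eval 0 ^ 2)) * Φ (n + 1) +
        C (ℓ / 2 * (1 - (Φ (n + 1)).eval 0 ^ 2) * (Φ (n + 2)).eval 0) * (X * reciprocal Φ n) +
        C (-(ℓ / 2 * (1 - (Φ (n + 1)).eval 0 ^ 2) * (Φ (n + 1)).eval 0)) * reciprocal Φ n := by
    rw [hΦ.sq_mul_derivative]
    simp only [C_mul, C_sub, C_pow, C_1, C_neg]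
    ring
  -- By this identity the moments left by pulling out `X` cancel. For `n > 0` both sides vanish; for
  -- `n = 0` the norm recursion gives equality.
  have hX : pairing (weight ℓ) (X * Φ (n + 1)) (X ^ n) = -((Φ (n + 2)).eval 0 *
      (1 - (Φ (n + 1)).eval 0 ^ 2) * pairing (weight ℓ) (reciprocal Φ n) (X ^ n)) := by
    rw [eq_sub_of_add_eq (hΦ.szego (n + 1)).symm, pairing_sub_left, pairing_C_mul_left,
      hΦ.pairing_X_pow_of_lt (by omega), hΦ.pairing_reciprocal_X_pow (by omega),
      hΦ.pairing_reciprocal_X_pow le_rfl, hΦ.norm_sq_succ]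
    split_ifs <;> ring
  rw [sq_mul_deriv_cauchyTransform ℓ n _ hz, hQ]
  simp only [cauchyTransform_add _ _ _ _ hz, cauchyTransform_C_mul, cauchyTransform_X_mul _ _ _ hz,
    hX, hΦ.pairing_X_pow_of_lt n.lt_succ_self]
  ring

theorem sq_mul_deriv_GStar (hΦ : IsMonicOPUC (weight ℓ) Φ κ) (n : ℕ) {z : ℂ}
    (hz : z ∉ Metric.sphere (0 : ℂ) 1) :
    z ^ 2 * deriv (GStar (weight ℓ) Φ n) z =
      ℓ / 2 * ((Φ n).eval 0 * z - (Φ (n + 1)).eval 0) * G (weight ℓ) Φ (n + 1) z +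
        (-((n + 1) * z) - ℓ / 2 * (1 - (Φ (n + 1)).eval 0 ^ 2)) * GStar (weight ℓ) Φ n z := by
  change z ^ 2 * deriv (cauchyTransform ℓ (n + 1) (reciprocal Φ n)) z =
    _ * cauchyTransform ℓ (n + 1) (Φ (n + 1)) z +
      _ * cauchyTransform ℓ (n + 1) (reciprocal Φ n) z
  have hQ : X ^ 2 * derivative (reciprocal Φ n) - C (n + 1 : ℂ) * (X * reciprocal Φ n) +
        C (ℓ / 2 : ℂ) * ((X ^ 2 - 1) * reciprocal Φ n) =
      C (ℓ / 2 * (Φ n).eval 0) * (X * Φ (n + 1)) +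
        C (-(ℓ / 2 * (Φ (n + 1)).eval 0)) * Φ (n + 1) +
        C (-(n + 1 : ℂ)) * (X * reciprocal Φ n) +
        C (-(ℓ / 2 * (1 - (Φ (n + 1)).eval 0 ^ 2))) * reciprocal Φ n := by
    rw [hΦ.sq_mul_derivative_reciprocal]
    simp only [C_mul, C_sub, C_pow, C_1, C_neg]
    ring
  -- The leftover moments add up to a multiple of this one, killed by orthogonality for `n > 0` and
  -- by the factor `n` for `n = 0`.
  have hn : (n : ℂ) * pairing (weight ℓ) (reciprocal Φ n) (X ^ n) = 0 := by
    rw [hΦ.pairing_reciprocal_X_pow le_rfl]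
    split_ifs with h <;> simp [h]
  rw [sq_mul_deriv_cauchyTransform ℓ n _ hz, hQ]
  simp only [cauchyTransform_add _ _ _ _ hz, cauchyTransform_C_mul, cauchyTransform_X_mul _ _ _ hz,
    hΦ.pairing_X_pow_of_lt n.lt_succ_self]
  linear_combination -(2 * (Real.pi : ℂ))⁻¹ * hn

/-! ### The determinant -/

theorem map_conj_reflect_reciprocal (hΦ : IsMonicOPUC (weight ℓ) Φ κ) (n : ℕ) :
    ((reciprocal Φ n).reflect n).map (starRingEnd ℂ) = Φ n := by
  conv_rhs => rw [← hΦ.map_conj_eq n]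
  rw [hΦ.reciprocal_eq_reflect]
  ext k
  rw [coeff_map, coeff_reflect, coeff_reflect, revAt_invol, coeff_map]

/-- The Cauchy transform of `Φ_n^* Φ_{n+1}` is expanded by pulling out either factor at `z`. In one
expansion the leftover moment pairs `Φ_{n+1}` with a polynomial of degree at most `n` and vanishes.
In the other it pairs a monic quotient of degree `n` with `Φ_n`, which gives `κ_n⁻²`. -/
theorem casoratian (hΦ : IsMonicOPUC (weight ℓ) Φ κ) (n : ℕ) {z : ℂ}
    (hz : z ∉ Metric.sphere (0 : ℂ) 1) :
    (reciprocal Φ n).eval z * G (weight ℓ) Φ (n + 1) z -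
      (Φ (n + 1)).eval z * GStar (weight ℓ) Φ n z = (bCoeff κ n)⁻¹ := by
  change _ * cauchyTransform ℓ (n + 1) (Φ (n + 1)) z -
      _ * cauchyTransform ℓ (n + 1) (reciprocal Φ n) z = _
  have h1 := cauchyTransform_mul ℓ n (Φ (n + 1)) (reciprocal Φ n) hz
  have h2 := cauchyTransform_mul ℓ n (reciprocal Φ n) (Φ (n + 1)) hz
  have hd1 : (reciprocal Φ n /ₘ (X - C z)).natDegree ≤ n :=
    (natDegree_divByMonic _ (monic_X_sub_C z)).le.trans
      ((Nat.sub_le _ _).trans (hΦ.natDegree_reciprocal_le n))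
  rw [pairing_mul_X_pow ℓ hd1, hΦ.pairing_eq_zero_of_degree_lt] at h1
  swap
  · rw [degree_map, degree_lt_iff_coeff_zero]
    intro m hm
    rw [coeff_reflect, revAt_eq_self_of_lt (by omega)]
    exact coeff_eq_zero_of_natDegree_lt (by omega)
  have hmon : (Φ (n + 1) /ₘ (X - C z)).Monic := by
    rw [Monic, leadingCoeff_divByMonic_of_monic (monic_X_sub_C z), (hΦ.monic _).leadingCoeff]
    rw [degree_X_sub_C, hΦ.degree_eq]
    exact_mod_cast Nat.le_add_left 1 n
  have hdeg : (Φ (n + 1) /ₘ (X - C z)).natDegree = n := by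
    rw [natDegree_divByMonic _ (monic_X_sub_C z), hΦ.natDegree_eq, natDegree_X_sub_C,
      Nat.add_sub_cancel]
  rw [mul_comm (Φ (n + 1) /ₘ (X - C z)), pairing_mul_X_pow ℓ (hΦ.natDegree_reciprocal_le n),
    hΦ.map_conj_reflect_reciprocal, pairing_conj, hΦ.pairing_of_monic hmon hdeg,
    conj_norm_sq, mul_comm (Φ (n + 1)) (reciprocal Φ n)] at h2
  rw [bCoeff, mul_inv]
  linear_combination h2 - h1

theorem bCoeff_ne_zero (hΦ : IsMonicOPUC (weight ℓ) Φ κ) (n : ℕ) : bCoeff κ n ≠ 0 := by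
  have h := (hΦ.kappa_pos n).ne'
  have hpi := Real.pi_ne_zero
  exact mul_ne_zero (mul_ne_zero two_ne_zero (by exact_mod_cast hpi))
    (pow_ne_zero _ (by exact_mod_cast h))

theorem bCoeff_ratio (hΦ : IsMonicOPUC (weight ℓ) Φ κ) (n : ℕ) :
    bCoeff κ n * (bCoeff κ (n + 1))⁻¹ = 1 - (Φ (n + 1)).eval 0 ^ 2 := by
  have h0 := hΦ.norm_sq_ne_zero n
  have hpi : (Real.pi : ℂ) ≠ 0 := by exact_mod_cast Real.pi_ne_zero
  have h : (κ n : ℂ) ^ 2 * ((κ n : ℂ) ^ 2)⁻¹ = 1 :=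
    mul_inv_cancel₀ fun h => h0 (by rw [h, inv_zero])
  rw [bCoeff, bCoeff, mul_inv, hΦ.norm_sq_succ]
  have h2 : 2 * (Real.pi : ℂ) * (2 * (Real.pi : ℂ))⁻¹ = 1 := by
    field_simp
  linear_combination (1 - (Φ (n + 1)).eval 0 ^ 2) * (κ n : ℂ) ^ 2 * ((κ n : ℂ) ^ 2)⁻¹ * h2 +
    (1 - (Φ (n + 1)).eval 0 ^ 2) * h

theorem det_Y (hΦ : IsMonicOPUC (weight ℓ) Φ κ) (n : ℕ) {z : ℂ}
    (hz : z ∉ Metric.sphere (0 : ℂ) 1) : (Y (weight ℓ) Φ κ (n + 1) z).det = 1 := by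
  have h := hΦ.casoratian n hz
  have hb := mul_inv_cancel₀ (hΦ.bCoeff_ne_zero n)
  rw [Y, Matrix.det_fin_two_of, Nat.add_sub_cancel]
  linear_combination bCoeff κ n * h + hb

end IsMonicOPUC

/-! ### Second order equations from a first order system -/

/-- Elimination of `g` from a system `z² f' = A f + B g`, `z² g' = D f + E g` with
polynomial coefficients of degree at most two for which `A E - B D - z² A'` is divisible
by `z²`. -/
theorem second_order_of_first_order {U : Set ℂ} (hU : IsOpen U) {f g : ℂ → ℂ}
    (hf : DifferentiableOn ℂ f U) (hg : DifferentiableOn ℂ g U)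
    (a₀ a₁ a₂ b₀ b₁ d₀ d₁ e₀ e₁ e₂ t₀ t₁ : ℂ)
    (h1 : ∀ z ∈ U, z ^ 2 * deriv f z = (a₀ + a₁ * z + a₂ * z ^ 2) * f z + (b₀ + b₁ * z) * g z)
    (h2 : ∀ z ∈ U, z ^ 2 * deriv g z = (d₀ + d₁ * z) * f z + (e₀ + e₁ * z + e₂ * z ^ 2) * g z)
    (hT : ∀ z : ℂ, (a₀ + a₁ * z + a₂ * z ^ 2) * (e₀ + e₁ * z + e₂ * z ^ 2) -
      (b₀ + b₁ * z) * (d₀ + d₁ * z) = z ^ 2 * (t₀ + t₁ * z + (a₁ + 2 * a₂ * z))) :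
    ∀ z ∈ U, z ^ 2 * deriv (deriv f) z +
      (2 * z - (a₀ + a₁ * z + a₂ * z ^ 2) - (e₀ + e₁ * z + e₂ * z ^ 2)) * deriv f z +
      (t₀ + t₁ * z) * f z = b₁ * g z := by
  have hf' := hf.deriv hU
  have hf'' := hf'.deriv hU
  have hne : ∀ z ∈ U, z ≠ 0 → z ^ 2 * deriv (deriv f) z +
      (2 * z - (a₀ + a₁ * z + a₂ * z ^ 2) - (e₀ + e₁ * z + e₂ * z ^ 2)) * deriv f z +
      (t₀ + t₁ * z) * f z = b₁ * g z := by
    intro z hz h0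
    have hN := hU.mem_nhds hz
    have hd1 := (hf.differentiableAt hN).hasDerivAt
    have hd2 := (hg.differentiableAt hN).hasDerivAt
    have hd3 := (hf'.differentiableAt hN).hasDerivAt
    have hl := (hasDerivAt_pow 2 z).mul hd3
    have hA : HasDerivAt (fun w => a₀ + a₁ * w + a₂ * w ^ 2) (a₁ + 2 * a₂ * z) z := by
      refine ((((hasDerivAt_id z).const_mul a₁).const_add a₀).add
        ((hasDerivAt_pow 2 z).const_mul a₂)).congr_deriv ?_
      norm_num
      ring
    have hB : HasDerivAt (fun w => b₀ + b₁ * w) b₁ z := by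
      simpa using ((hasDerivAt_id z).const_mul b₁).const_add b₀
    have hev : (fun w => w ^ 2) * deriv f =ᶠ[nhds z]
        (fun w => a₀ + a₁ * w + a₂ * w ^ 2) * f + (fun w => b₀ + b₁ * w) * g := by
      filter_upwards [hN] with w hw
      exact h1 w hw
    have key := (((hA.mul hd1).add (hB.mul hd2)).congr_of_eventuallyEq hev).unique hl
    norm_num at key
    -- After multiplication by `z²`, `z² g'` is replaced by the second equation and `B g` by the
    -- first. Only `B' g = b₁ g` survives, and `hT` supplies the divisible coefficient of `f`.
    refine mul_left_cancel₀ (pow_ne_zero 2 h0) ?_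
    linear_combination -z ^ 2 * key + (b₀ + b₁ * z) * h2 z hz -
      (e₀ + e₁ * z + e₂ * z ^ 2) * h1 z hz - f z * hT z
  intro z hz
  by_cases h0 : z = 0
  · have hN := hU.mem_nhds hz
    have c0 := (hf.differentiableAt hN).continuousAt
    have c1 := (hf'.differentiableAt hN).continuousAt
    have c2 := (hf''.differentiableAt hN).continuousAt
    have c3 := (hg.differentiableAt hN).continuousAt
    have hL : ContinuousAt (fun z => z ^ 2 * deriv (deriv f) z +
      (2 * z - (a₀ + a₁ * z + a₂ * z ^ 2) - (e₀ + e₁ * z + e₂ * z ^ 2)) * deriv f z +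
      (t₀ + t₁ * z) * f z) z := by fun_prop
    have hR : ContinuousAt (fun z => b₁ * g z) z := by fun_prop
    -- The division by `z²` is lost at the origin, but both sides are continuous there and agree on
    -- a punctured neighbourhood.
    refine ((hL.eventuallyEq_nhds_iff_eventuallyEq_nhdsNE hR).1 ?_).eq_of_nhds
    subst h0
    filter_upwards [self_mem_nhdsWithin, mem_nhdsWithin_of_mem_nhds hN] with w hw hwU
    exact hne w hwU hw
  · exact hne z hz h0

/-! ### Entrywise derivatives -/

theorem mderiv_mul {F H : ℂ → Matrix (Fin 2) (Fin 2) ℂ} {z : ℂ}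
    (hF : ∀ i j, DifferentiableAt ℂ (fun w => F w i j) z)
    (hH : ∀ i j, DifferentiableAt ℂ (fun w => H w i j) z) :
    mderiv (fun w => F w * H w) z = mderiv F z * H z + F z * mderiv H z := by
  ext i j
  simp only [mderiv, Matrix.of_apply, Matrix.add_apply, Matrix.mul_apply, Fin.sum_univ_two]
  have h := ((hF i 0).hasDerivAt.mul (hH 0 j).hasDerivAt).add
    ((hF i 1).hasDerivAt.mul (hH 1 j).hasDerivAt)
  refine h.deriv.trans ?_
  ring

theorem mderiv_sq_smul {F : ℂ → Matrix (Fin 2) (Fin 2) ℂ} {z : ℂ}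
    (hF : ∀ i j, DifferentiableAt ℂ (fun w => F w i j) z) :
    mderiv (fun w => w ^ 2 • F w) z = (2 * z) • F z + z ^ 2 • mderiv F z := by
  ext i j
  simp only [mderiv, Matrix.of_apply, Matrix.add_apply, Matrix.smul_apply, smul_eq_mul]
  refine ((hasDerivAt_pow 2 z).mul (hF i j).hasDerivAt).deriv.trans ?_
  norm_num

theorem mderiv_add {F H : ℂ → Matrix (Fin 2) (Fin 2) ℂ} {z : ℂ}
    (hF : ∀ i j, DifferentiableAt ℂ (fun w => F w i j) z)
    (hH : ∀ i j, DifferentiableAt ℂ (fun w => H w i j) z) :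
    mderiv (fun w => F w + H w) z = mderiv F z + mderiv H z := by
  ext i j
  exact ((hF i j).hasDerivAt.add (hH i j).hasDerivAt).deriv

theorem mderiv_congr {F H : ℂ → Matrix (Fin 2) (Fin 2) ℂ} {U : Set ℂ} (hU : IsOpen U)
    (h : ∀ w ∈ U, F w = H w) {z : ℂ} (hz : z ∈ U) : mderiv F z = mderiv H z := by
  ext i j
  refine Filter.EventuallyEq.deriv_eq ?_
  filter_upwards [hU.mem_nhds hz] with w hw
  rw [h w hw]

theorem differentiableOn_mderiv {F : ℂ → Matrix (Fin 2) (Fin 2) ℂ} {U : Set ℂ} (hU : IsOpen U)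
    (hF : ∀ i j, DifferentiableOn ℂ (fun w => F w i j) U) (i j : Fin 2) :
    DifferentiableOn ℂ (fun w => mderiv F w i j) U :=
  (hF i j).deriv hU

theorem differentiableAt_mul_apply {F H : ℂ → Matrix (Fin 2) (Fin 2) ℂ} {z : ℂ}
    (hF : ∀ i j, DifferentiableAt ℂ (fun w => F w i j) z)
    (hH : ∀ i j, DifferentiableAt ℂ (fun w => H w i j) z) (i j : Fin 2) :
    DifferentiableAt ℂ (fun w => (F w * H w) i j) z := by
  simp only [Matrix.mul_apply, Fin.sum_univ_two]
  exact ((hF i 0).mul (hH 0 j)).add ((hF i 1).mul (hH 1 j))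

/-! ### The matrix system -/

/-- A first order system for `Y C` gives the second order equation for `Y`. -/
theorem second_order_matrix {U : Set ℂ} (hU : IsOpen U)
    {F H N : ℂ → Matrix (Fin 2) (Fin 2) ℂ}
    (hF : ∀ i j, DifferentiableOn ℂ (fun w => F w i j) U)
    (hH : ∀ i j, DifferentiableOn ℂ (fun w => H w i j) U)
    (hN : ∀ i j, DifferentiableOn ℂ (fun w => N w i j) U)
    (hdet : ∀ w ∈ U, H w * (H w)⁻¹ = 1) (h0 : ∀ w ∈ U, w ≠ 0)
    (h : ∀ w ∈ U, w ^ 2 • mderiv (fun w => F w * H w) w = N w * (F w * H w)) {z : ℂ}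
    (hz : z ∈ U) :
    z ^ 2 • mderiv (mderiv F) z +
        2 • (mderiv F z * (z ^ 2 • (mderiv H z * (H z)⁻¹) + z • 1)) +
        F z * (z ^ 2 • (mderiv (mderiv H) z * (H z)⁻¹) + (2 * z) • (mderiv H z * (H z)⁻¹)) =
      (mderiv N z + (z ^ 2)⁻¹ • N z ^ 2) * F z := by
  have hd {K : ℂ → Matrix (Fin 2) (Fin 2) ℂ}
      (hK : ∀ i j, DifferentiableOn ℂ (fun w => K w i j) U) {w : ℂ} (hw : w ∈ U) (i j : Fin 2) :
      DifferentiableAt ℂ (fun w => K w i j) w := (hK i j).differentiableAt (hU.mem_nhds hw)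
  have hF' := differentiableOn_mderiv hU hF
  have hH' := differentiableOn_mderiv hU hH
  have hFH (i j : Fin 2) : DifferentiableOn ℂ (fun w => (F w * H w) i j) U := fun w hw =>
    (differentiableAt_mul_apply (hd hF hw) (hd hH hw) i j).differentiableWithinAt
  have hprod : ∀ w ∈ U, mderiv (fun w => F w * H w) w = mderiv F w * H w + F w * mderiv H w :=
    fun w hw => mderiv_mul (hd hF hw) (hd hH hw)
  have key := mderiv_congr hU h hz
  rw [mderiv_sq_smul (hd (differentiableOn_mderiv hU hFH) hz), mderiv_mul (hd hN hz) (hd hFH hz),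
    mderiv_congr hU hprod hz,
    mderiv_add (differentiableAt_mul_apply (hd hF' hz) (hd hH hz))
      (differentiableAt_mul_apply (hd hF hz) (hd hH' hz)),
    mderiv_mul (hd hF' hz) (hd hH hz), mderiv_mul (hd hF hz) (hd hH' hz)] at key
  have hz2 : z ^ 2 ≠ 0 := pow_ne_zero 2 (h0 z hz)
  have h1 : mderiv (fun w => F w * H w) z = (z ^ 2)⁻¹ • (N z * (F z * H z)) := by
    rw [← h z hz, smul_smul, inv_mul_cancel₀ hz2, one_smul]
  -- Only the derivative next to `N` is replaced through the system, which produces `N²`; the one on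
  -- the left is expanded by the product rule.
  conv_rhs at key => rw [h1]
  rw [hprod z hz] at key
  have key' := congrArg (· * (H z)⁻¹) key
  simp only [add_mul, smul_mul_assoc, mul_smul_comm, mul_assoc, hdet z hz, mul_one,
    smul_add] at key'
  simp only [add_mul, mul_add, smul_mul_assoc, mul_smul_comm, mul_assoc, mul_one, smul_add, sq]
    at key' ⊢
  rw [← key']
  module

theorem differentiableOn_Y (ℓ : ℝ) (Φ : ℕ → ℂ[X]) (κ : ℕ → ℝ) (n : ℕ) (i j : Fin 2) :
    DifferentiableOn ℂ (fun w => Y (weight ℓ) Φ κ (n + 1) w i j) (Metric.sphere 0 1)ᶜ := by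
  have hG : DifferentiableOn ℂ (G (weight ℓ) Φ (n + 1)) (Metric.sphere 0 1)ᶜ :=
    differentiableOn_cauchyTransform ℓ (n + 1) (Φ (n + 1))
  have hG' : DifferentiableOn ℂ (GStar (weight ℓ) Φ n) (Metric.sphere 0 1)ᶜ :=
    differentiableOn_cauchyTransform ℓ (n + 1) (reciprocal Φ n)
  fin_cases i <;> fin_cases j
  · exact (Φ (n + 1)).differentiable.differentiableOn
  · exact hG
  · exact (reciprocal Φ n).differentiable.differentiableOn.const_mul _
  · exact hG'.const_mul _

theorem differentiable_MTilde (ℓ : ℝ) (Φ : ℕ → ℂ[X]) (κ : ℕ → ℝ) (n : ℕ) (i j : Fin 2) :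
    Differentiable ℂ (fun w => MTilde ℓ Φ κ n w i j) := by
  fin_cases i <;> fin_cases j <;> simp [MTilde] <;> fun_prop

/-! ### Branches of the square roots and the diagonal factor. -/

namespace IsBranchPair

variable {ℓ : ℝ} {U : Set ℂ} {ρ σ : ℂ → ℂ}

theorem left_ne_zero (h : IsBranchPair (weight ℓ) U ρ σ) {z : ℂ} (hz : z ∈ U) (h0 : z ≠ 0) :
    ρ z ≠ 0 := fun hρ => h0 (by rw [← h.sq_left z hz, hρ]; simp)

theorem right_ne_zero (h : IsBranchPair (weight ℓ) U ρ σ) {z : ℂ} (hz : z ∈ U) : σ z ≠ 0 :=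
  fun hσ => Complex.exp_ne_zero _ (show weight ℓ z = 0 by rw [← h.sq_right z hz, hσ]; simp)

theorem hasDerivAt_left (h : IsBranchPair (weight ℓ) U ρ σ) {z : ℂ} (hz : z ∈ U) (h0 : z ≠ 0) :
    HasDerivAt ρ (ρ z / (2 * z)) z := by
  have hN := h.isOpen.mem_nhds hz
  have hd := (h.diff_left.differentiableAt hN).hasDerivAt
  have hev : ρ ^ 2 =ᶠ[nhds z] id := by
    filter_upwards [hN] with w hw
    exact h.sq_left w hw
  have key := (hd.pow 2).unique ((hasDerivAt_id z).congr_of_eventuallyEq hev)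
  have hρ := h.left_ne_zero hz h0
  refine hd.congr_deriv ?_
  rw [eq_div_iff (mul_ne_zero two_ne_zero h0)]
  have hs := h.sq_left z hz
  norm_num at key
  linear_combination ρ z * key - 2 * deriv ρ z * hs

theorem hasDerivAt_right (h : IsBranchPair (weight ℓ) U ρ σ) {z : ℂ} (hz : z ∈ U) (h0 : z ≠ 0) :
    HasDerivAt σ (ℓ / 4 * (1 - (z ^ 2)⁻¹) * σ z) z := by
  have hN := h.isOpen.mem_nhds hz
  have hd := (h.diff_right.differentiableAt hN).hasDerivAt
  have hev : σ ^ 2 =ᶠ[nhds z] weight ℓ := by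
    filter_upwards [hN] with w hw
    exact h.sq_right w hw
  have key := (hd.pow 2).unique ((hasDerivAt_weight ℓ h0).congr_of_eventuallyEq hev)
  have hσ := h.right_ne_zero hz
  refine hd.congr_deriv (mul_left_cancel₀ hσ ?_)
  have hs := h.sq_right z hz
  norm_num at key
  linear_combination (1 / 2 : ℂ) * key - (1 / 2 : ℂ) * (ℓ / 2 * (1 - (z ^ 2)⁻¹)) * hs

/-- The logarithmic derivative of `z^{-n/2} ν(z)^{1/2}`. -/
def logDerivCoeff (ℓ : ℝ) (n : ℕ) (z : ℂ) : ℂ :=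
  ℓ / 4 * (1 - (z ^ 2)⁻¹) - n / (2 * z)

theorem hasDerivAt_div (h : IsBranchPair (weight ℓ) U ρ σ) (n : ℕ) {z : ℂ} (hz : z ∈ U)
    (h0 : z ≠ 0) :
    HasDerivAt (fun w => σ w / ρ w ^ n) (logDerivCoeff ℓ n z * (σ z / ρ z ^ n)) z := by
  have hρ := h.left_ne_zero hz h0
  refine ((h.hasDerivAt_right hz h0).div ((h.hasDerivAt_left hz h0).pow n)
    (pow_ne_zero n hρ)).congr_deriv ?_
  simp only [logDerivCoeff, Pi.pow_apply]
  rcases n with _ | n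
  · simp
  · rw [Nat.add_sub_cancel]
    field_simp
    ring

theorem hasDerivAt_div_inv (h : IsBranchPair (weight ℓ) U ρ σ) (n : ℕ) {z : ℂ} (hz : z ∈ U)
    (h0 : z ≠ 0) :
    HasDerivAt (fun w => ρ w ^ n / σ w) (-logDerivCoeff ℓ n z * (ρ z ^ n / σ z)) z := by
  have hρ := pow_ne_zero n (h.left_ne_zero hz h0)
  have hσ := h.right_ne_zero hz
  have h1 := (h.hasDerivAt_div n hz h0).inv (div_ne_zero hσ hρ)
  have he : (fun w => ρ w ^ n / σ w) = (fun w => σ w / ρ w ^ n)⁻¹ := by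
    ext w; simp
  rw [he]
  refine h1.congr_deriv ?_
  field_simp

/-- The logarithmic derivative of `C_n` does not see the choice of branches, which is why the
structure matrix does not depend on it. -/
theorem mderiv_CMat (h : IsBranchPair (weight ℓ) U ρ σ) (n : ℕ) {z : ℂ} (hz : z ∈ U)
    (h0 : z ≠ 0) :
    mderiv (CMat ρ σ n) z =
      !![logDerivCoeff ℓ n z, 0; 0, -logDerivCoeff ℓ n z] * CMat ρ σ n z := by
  ext i j
  fin_cases i <;> fin_cases j
  · simpa [mderiv, CMat, Matrix.mul_apply] using (h.hasDerivAt_div n hz h0).deriv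
  · simp [mderiv, CMat, Matrix.mul_apply]
  · simp [mderiv, CMat, Matrix.mul_apply]
  · simpa [mderiv, CMat, Matrix.mul_apply] using (h.hasDerivAt_div_inv n hz h0).deriv

theorem differentiableOn_CMat (h : IsBranchPair (weight ℓ) U ρ σ) (hU : ∀ z ∈ U, z ≠ 0) (n : ℕ)
    (i j : Fin 2) : DifferentiableOn ℂ (fun w => CMat ρ σ n w i j) U := by
  intro z hz
  refine DifferentiableAt.differentiableWithinAt ?_
  fin_cases i <;> fin_cases j
  · exact (h.hasDerivAt_div n hz (hU z hz)).differentiableAt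
  · exact differentiableAt_const (0 : ℂ)
  · exact differentiableAt_const (0 : ℂ)
  · exact (h.hasDerivAt_div_inv n hz (hU z hz)).differentiableAt

theorem det_CMat (h : IsBranchPair (weight ℓ) U ρ σ) (n : ℕ) {z : ℂ} (hz : z ∈ U) (h0 : z ≠ 0) :
    (CMat ρ σ n z).det = 1 := by
  have hρ := h.left_ne_zero hz h0
  have hσ := h.right_ne_zero hz
  rw [CMat, Matrix.det_fin_two_of]
  field_simp
  ring

end IsBranchPair

/-! ### Verblunsky coefficients -/

namespace IsMonicOPUC

variable {ℓ : ℝ} {Φ : ℕ → ℂ[X]} {κ : ℕ → ℝ}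

theorem verblunsky_eq (hΦ : IsMonicOPUC (weight ℓ) Φ κ) {k : ℤ} {m : ℕ} (hk : k + 1 = m) :
    verblunsky Φ k = -(Φ m).eval 0 := by
  rw [verblunsky, hk, Int.toNat_natCast, hΦ.conj_eval_zero]

theorem im_verblunsky (hΦ : IsMonicOPUC (weight ℓ) Φ κ) (k : ℤ) : (verblunsky Φ k).im = 0 := by
  rw [verblunsky, hΦ.conj_eval_zero, Complex.neg_im,
    Complex.conj_eq_iff_im.1 (hΦ.conj_eval_zero _), neg_zero]

/-- The ratio of consecutive `b`'s is `1 - α²`, so everything on the diagonal is a polynomial in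
`Φ_{n+1}(0)`. -/
theorem MTilde_eq (hΦ : IsMonicOPUC (weight ℓ) Φ κ) (n : ℕ) (z : ℂ) :
    MTilde ℓ Φ κ (n + 1) z =
      !![(ℓ : ℂ) / 4 * z ^ 2 + (n + 1) / 2 * z + ℓ / 4 * (1 - 2 * (Φ (n + 1)).eval 0 ^ 2),
          -(ℓ : ℂ) / 2 * (bCoeff κ (n + 1))⁻¹ * ((Φ (n + 2)).eval 0 * z - (Φ (n + 1)).eval 0);
        -(ℓ : ℂ) / 2 * bCoeff κ n * ((Φ n).eval 0 * z - (Φ (n + 1)).eval 0),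
          -((ℓ : ℂ) / 4 * z ^ 2 + (n + 1) / 2 * z +
            ℓ / 4 * (1 - 2 * (Φ (n + 1)).eval 0 ^ 2))] := by
  simp only [MTilde, Nat.add_sub_cancel, hΦ.bCoeff_ratio,
    hΦ.verblunsky_eq (k := ((n + 1 : ℕ) : ℤ) - 1) (m := n + 1) (by push_cast; ring),
    hΦ.verblunsky_eq (k := ((n + 1 : ℕ) : ℤ)) (m := n + 2) (by push_cast; ring),
    hΦ.verblunsky_eq (k := ((n + 1 : ℕ) : ℤ) - 2) (m := n) (by push_cast; ring)]
  ext i j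
  fin_cases i <;> fin_cases j <;>
    simp [-mul_eq_mul_left_iff, -mul_eq_mul_right_iff, -add_right_inj, -add_left_inj] <;> ring

/-- The systems for the two columns of `Y` differ by a scalar matrix; the diagonal correction on the
right splits this difference evenly, giving both columns the same trace-free matrix. -/
theorem sq_smul_mderiv_Y (hΦ : IsMonicOPUC (weight ℓ) Φ κ) (n : ℕ) {z : ℂ}
    (hz : z ∉ Metric.sphere (0 : ℂ) 1) (h0 : z ≠ 0) :
    z ^ 2 • mderiv (Y (weight ℓ) Φ κ (n + 1)) z =
      MTilde ℓ Φ κ (n + 1) z * Y (weight ℓ) Φ κ (n + 1) z -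
        z ^ 2 • (Y (weight ℓ) Φ κ (n + 1) z *
          !![IsBranchPair.logDerivCoeff ℓ (n + 1) z, 0;
            0, -IsBranchPair.logDerivCoeff ℓ (n + 1) z]) := by
  have hs : z ^ 2 * IsBranchPair.logDerivCoeff ℓ (n + 1) z =
      ℓ / 4 * (z ^ 2 - 1) - (n + 1) / 2 * z := by
    rw [IsBranchPair.logDerivCoeff]
    push_cast
    field_simp
  have hr := hΦ.bCoeff_ratio n
  have e1 := congrArg (eval z) (hΦ.sq_mul_derivative n)
  have e2 := hΦ.sq_mul_deriv_G n hz
  have e3 := congrArg (eval z) (hΦ.sq_mul_derivative_reciprocal n)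
  have e4 := hΦ.sq_mul_deriv_GStar n hz
  simp only [eval_mul, eval_add, eval_sub, eval_pow, eval_X, eval_C] at e1 e3
  have hd1 : mderiv (Y (weight ℓ) Φ κ (n + 1)) z =
      !![(derivative (Φ (n + 1))).eval z, deriv (G (weight ℓ) Φ (n + 1)) z;
        -bCoeff κ n * (derivative (reciprocal Φ n)).eval z,
          -bCoeff κ n * deriv (GStar (weight ℓ) Φ n) z] := by
    ext i j
    fin_cases i <;> fin_cases j
    · exact (Φ (n + 1)).deriv
    · rfl
    · exact ((reciprocal Φ n).hasDerivAt z |>.const_mul _).deriv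
    · exact ((hasDerivAt_cauchyTransform ℓ (n + 1) (reciprocal Φ n)
        hz).differentiableAt.hasDerivAt.const_mul _).deriv
  rw [hd1, hΦ.MTilde_eq, Y, Nat.add_sub_cancel]
  ext i j
  fin_cases i <;> fin_cases j <;> simp
  · linear_combination e1 + (Φ (n + 1)).eval z * hs - ℓ / 2 * ((Φ (n + 2)).eval 0 * z -
      (Φ (n + 1)).eval 0) * (reciprocal Φ n).eval z * hr
  · linear_combination e2 - G (weight ℓ) Φ (n + 1) z * hs - ℓ / 2 * ((Φ (n + 2)).eval 0 * z -
      (Φ (n + 1)).eval 0) * GStar (weight ℓ) Φ n z * hr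
  · linear_combination -bCoeff κ n * e3 - bCoeff κ n * (reciprocal Φ n).eval z * hs
  · linear_combination -bCoeff κ n * e4 + bCoeff κ n * GStar (weight ℓ) Φ n z * hs

end IsMonicOPUC

/-! ### The structure matrix and the matrix equations. -/

namespace IsMonicOPUC

variable {ℓ : ℝ} {Φ : ℕ → ℂ[X]} {κ : ℕ → ℝ}

theorem matrix_system (hΦ : IsMonicOPUC (weight ℓ) Φ κ) (n : ℕ) {U : Set ℂ} {ρ σ : ℂ → ℂ}
    (hU : U ⊆ (Metric.sphere 0 1 ∪ {0})ᶜ) (h : IsBranchPair (weight ℓ) U ρ σ) {z : ℂ}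
    (hz : z ∈ U) :
    z ^ 2 • M (weight ℓ) Φ κ ρ σ (n + 1) z = MTilde ℓ Φ κ (n + 1) z ∧
    z ^ 2 • mderiv (Y (weight ℓ) Φ κ (n + 1)) z =
      MTilde ℓ Φ κ (n + 1) z * Y (weight ℓ) Φ κ (n + 1) z -
        z ^ 2 • (Y (weight ℓ) Φ κ (n + 1) z * mderiv (CMat ρ σ (n + 1)) z *
          (CMat ρ σ (n + 1) z)⁻¹) ∧
    z ^ 2 • mderiv (mderiv (Y (weight ℓ) Φ κ (n + 1))) z +
        2 • (mderiv (Y (weight ℓ) Φ κ (n + 1)) z *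
          (z ^ 2 • (mderiv (CMat ρ σ (n + 1)) z * (CMat ρ σ (n + 1) z)⁻¹) + z • 1)) +
        Y (weight ℓ) Φ κ (n + 1) z *
          (z ^ 2 • (mderiv (mderiv (CMat ρ σ (n + 1))) z * (CMat ρ σ (n + 1) z)⁻¹) +
            (2 * z) • (mderiv (CMat ρ σ (n + 1)) z * (CMat ρ σ (n + 1) z)⁻¹)) =
      (mderiv (MTilde ℓ Φ κ (n + 1)) z + (z ^ 2)⁻¹ • MTilde ℓ Φ κ (n + 1) z ^ 2) *
        Y (weight ℓ) Φ κ (n + 1) z := by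
  have hS : ∀ w ∈ U, w ∉ Metric.sphere (0 : ℂ) 1 := fun w hw hs => hU hw (Or.inl hs)
  have h0 : ∀ w ∈ U, w ≠ 0 := fun w hw h0 => hU hw (Or.inr h0)
  have hC : ∀ w ∈ U, CMat ρ σ (n + 1) w * (CMat ρ σ (n + 1) w)⁻¹ = 1 := fun w hw =>
    Matrix.mul_nonsing_inv _ (by rw [h.det_CMat _ hw (h0 w hw)]; exact isUnit_one)
  have hdY (i j : Fin 2) : DifferentiableOn ℂ (fun w => Y (weight ℓ) Φ κ (n + 1) w i j) U :=
    (differentiableOn_Y ℓ Φ κ n i j).mono hS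
  have hdC := h.differentiableOn_CMat h0 (n + 1)
  have hfirst : ∀ w ∈ U, w ^ 2 • mderiv (Y (weight ℓ) Φ κ (n + 1)) w =
      MTilde ℓ Φ κ (n + 1) w * Y (weight ℓ) Φ κ (n + 1) w -
        w ^ 2 • (Y (weight ℓ) Φ κ (n + 1) w * mderiv (CMat ρ σ (n + 1)) w *
          (CMat ρ σ (n + 1) w)⁻¹) := by
    intro w hw
    rw [h.mderiv_CMat _ hw (h0 w hw), mul_assoc, mul_assoc, hC w hw, mul_one,
      hΦ.sq_smul_mderiv_Y n (hS w hw) (h0 w hw)]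
  have hZ : ∀ w ∈ U,
      w ^ 2 • mderiv (fun w => Y (weight ℓ) Φ κ (n + 1) w * CMat ρ σ (n + 1) w) w =
        MTilde ℓ Φ κ (n + 1) w * (Y (weight ℓ) Φ κ (n + 1) w * CMat ρ σ (n + 1) w) := by
    intro w hw
    have hN := h.isOpen.mem_nhds hw
    have hC' : (CMat ρ σ (n + 1) w)⁻¹ * CMat ρ σ (n + 1) w = 1 :=
      Matrix.nonsing_inv_mul _ (by rw [h.det_CMat _ hw (h0 w hw)]; exact isUnit_one)
    rw [mderiv_mul (fun i j => (hdY i j).differentiableAt hN)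
      fun i j => (hdC i j).differentiableAt hN, smul_add, ← smul_mul_assoc, hfirst w hw, sub_mul,
      smul_mul_assoc, mul_assoc _ (CMat ρ σ (n + 1) w)⁻¹, hC', mul_one, sub_add_cancel, mul_assoc]
  refine ⟨?_, hfirst z hz, second_order_matrix h.isOpen hdY hdC
    (fun i j => (differentiable_MTilde ℓ Φ κ (n + 1) i j).differentiableOn) hC h0 hZ hz⟩
  have hdet : IsUnit (Y (weight ℓ) Φ κ (n + 1) z * CMat ρ σ (n + 1) z).det := by
    rw [Matrix.det_mul, hΦ.det_Y n (hS z hz), h.det_CMat _ hz (h0 z hz), mul_one]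
    exact isUnit_one
  change z ^ 2 • (mderiv (fun w => Y (weight ℓ) Φ κ (n + 1) w * CMat ρ σ (n + 1) w) z *
    (Y (weight ℓ) Φ κ (n + 1) z * CMat ρ σ (n + 1) z)⁻¹) = _
  rw [← smul_mul_assoc, hZ z hz, mul_assoc, Matrix.mul_nonsing_inv _ hdet, mul_one]

/-! ### Second order relations -/

/-- The coefficient `K_n` of the second order relations. -/
def secondOrderConst (ℓ : ℝ) (Φ : ℕ → ℂ[X]) (n : ℕ) : ℂ :=
  ℓ ^ 2 / 4 * ((1 - (Φ (n + 1)).eval 0 ^ 2) * (Φ (n + 2)).eval 0 * (Φ n).eval 0 -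
    (Φ (n + 1)).eval 0 ^ 2)

theorem second_order_polynomial (hΦ : IsMonicOPUC (weight ℓ) Φ κ) (n : ℕ) (z : ℂ) :
    (z ^ 2 * (derivative (derivative (Φ (n + 1)))).eval z +
        (ℓ / 2 * z ^ 2 + (2 - (n + 1)) * z - ℓ / 2) * (derivative (Φ (n + 1))).eval z +
        (-(ℓ * (n + 1) / 2 * z) - ℓ ^ 2 / 4 - (n + 1) - secondOrderConst ℓ Φ n) *
          (Φ (n + 1)).eval z =
      ℓ / 2 * (1 - (Φ (n + 1)).eval 0 ^ 2) * (Φ (n + 2)).eval 0 * (reciprocal Φ n).eval z) ∧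
    z ^ 2 * (derivative (derivative (reciprocal Φ n))).eval z +
        (ℓ / 2 * z ^ 2 + (2 - (n + 1)) * z - ℓ / 2) * (derivative (reciprocal Φ n)).eval z -
        (ℓ * ((n + 1) / 2 - 1) * z + ℓ ^ 2 / 4 + secondOrderConst ℓ Φ n) *
          (reciprocal Φ n).eval z =
      ℓ / 2 * (Φ n).eval 0 * (Φ (n + 1)).eval z := by
  have hd (P : ℂ[X]) : deriv (fun w => P.eval w) = fun w => (derivative P).eval w := by
    ext w; exact P.deriv
  have e1 (w : ℂ) := congrArg (eval w) (hΦ.sq_mul_derivative n)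
  have e2 (w : ℂ) := congrArg (eval w) (hΦ.sq_mul_derivative_reciprocal n)
  simp only [eval_mul, eval_add, eval_sub, eval_pow, eval_X, eval_C] at e1 e2
  have hp := hΦ.painleve n
  set a := (Φ (n + 1)).eval 0 with ha
  have h1 := second_order_of_first_order isOpen_univ (f := fun w => (Φ (n + 1)).eval w)
    (g := fun w => (reciprocal Φ n).eval w) (Φ (n + 1)).differentiable.differentiableOn
    (reciprocal Φ n).differentiable.differentiableOn (ℓ / 2 * (1 - a ^ 2)) (n + 1) 0
    (-(ℓ / 2 * (1 - a ^ 2) * a)) (ℓ / 2 * (1 - a ^ 2) * (Φ (n + 2)).eval 0)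
    (-(ℓ / 2 * a)) (ℓ / 2 * (Φ n).eval 0) (ℓ / 2 * a ^ 2) 0 (-(ℓ / 2))
    (-(ℓ ^ 2 / 4) - (n + 1) - secondOrderConst ℓ Φ n) (-(ℓ * (n + 1) / 2))
    (fun w _ => by rw [hd]; linear_combination e1 w)
    (fun w _ => by rw [hd]; linear_combination e2 w)
    -- In `A E - B D` the constant terms cancel identically, and the coefficient of `w` is `ℓ a / 2`
    -- times the Painlevé expression.
    (fun w => by rw [secondOrderConst, ← ha]; linear_combination w * ℓ / 2 * a * hp) z trivial
  have h2 := second_order_of_first_order isOpen_univ (f := fun w => (reciprocal Φ n).eval w)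
    (g := fun w => (Φ (n + 1)).eval w) (reciprocal Φ n).differentiable.differentiableOn
    (Φ (n + 1)).differentiable.differentiableOn (ℓ / 2 * a ^ 2) 0 (-(ℓ / 2))
    (-(ℓ / 2 * a)) (ℓ / 2 * (Φ n).eval 0)
    (-(ℓ / 2 * (1 - a ^ 2) * a)) (ℓ / 2 * (1 - a ^ 2) * (Φ (n + 2)).eval 0)
    (ℓ / 2 * (1 - a ^ 2)) (n + 1) 0
    (-(ℓ ^ 2 / 4) - secondOrderConst ℓ Φ n) (-(ℓ * ((n + 1) / 2 - 1)))
    (fun w _ => by rw [hd]; linear_combination e2 w)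
    (fun w _ => by rw [hd]; linear_combination e1 w)
    (fun w => by rw [secondOrderConst, ← ha]; linear_combination w * ℓ / 2 * a * hp) z trivial
  simp only [hd] at h1 h2
  constructor
  · linear_combination h1
  · linear_combination h2

theorem second_order_G (hΦ : IsMonicOPUC (weight ℓ) Φ κ) (n : ℕ) {z : ℂ}
    (hz : z ∉ Metric.sphere (0 : ℂ) 1) :
    (z ^ 2 * deriv (deriv (G (weight ℓ) Φ (n + 1))) z +
        (-(ℓ / 2 * z ^ 2) + (n + 1 + 2) * z + ℓ / 2) * deriv (G (weight ℓ) Φ (n + 1)) z -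
        (ℓ * ((n + 1) / 2 + 1) * z + ℓ ^ 2 / 4 + secondOrderConst ℓ Φ n) *
          G (weight ℓ) Φ (n + 1) z =
      ℓ / 2 * (1 - (Φ (n + 1)).eval 0 ^ 2) * (Φ (n + 2)).eval 0 * GStar (weight ℓ) Φ n z) ∧
    z ^ 2 * deriv (deriv (GStar (weight ℓ) Φ n)) z +
        (-(ℓ / 2 * z ^ 2) + (n + 1 + 2) * z + ℓ / 2) * deriv (GStar (weight ℓ) Φ n) z -
        (ℓ * (n + 1) / 2 * z + ℓ ^ 2 / 4 - (n + 1) + secondOrderConst ℓ Φ n) *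
          GStar (weight ℓ) Φ n z =
      ℓ / 2 * (Φ n).eval 0 * G (weight ℓ) Φ (n + 1) z := by
  have hU : IsOpen (Metric.sphere (0 : ℂ) 1)ᶜ := Metric.isClosed_sphere.isOpen_compl
  have hG : DifferentiableOn ℂ (G (weight ℓ) Φ (n + 1)) (Metric.sphere 0 1)ᶜ :=
    differentiableOn_cauchyTransform ℓ (n + 1) (Φ (n + 1))
  have hG' : DifferentiableOn ℂ (GStar (weight ℓ) Φ n) (Metric.sphere 0 1)ᶜ :=
    differentiableOn_cauchyTransform ℓ (n + 1) (reciprocal Φ n)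
  have e1 {w : ℂ} (hw : w ∉ Metric.sphere (0 : ℂ) 1) := hΦ.sq_mul_deriv_G n hw
  have e2 {w : ℂ} (hw : w ∉ Metric.sphere (0 : ℂ) 1) := hΦ.sq_mul_deriv_GStar n hw
  have hp := hΦ.painleve n
  set a := (Φ (n + 1)).eval 0 with ha
  have h1 := second_order_of_first_order hU hG hG' (-(ℓ / 2 * a ^ 2)) 0 (ℓ / 2)
    (-(ℓ / 2 * (1 - a ^ 2) * a)) (ℓ / 2 * (1 - a ^ 2) * (Φ (n + 2)).eval 0)
    (-(ℓ / 2 * a)) (ℓ / 2 * (Φ n).eval 0) (-(ℓ / 2 * (1 - a ^ 2))) (-(n + 1)) 0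
    (-(ℓ ^ 2 / 4) - secondOrderConst ℓ Φ n) (-(ℓ * ((n + 1) / 2 + 1)))
    (fun w hw => by linear_combination e1 hw)
    (fun w hw => by linear_combination e2 hw)
    (fun w => by rw [secondOrderConst, ← ha]; linear_combination w * ℓ / 2 * a * hp) z hz
  have h2 := second_order_of_first_order hU hG' hG (-(ℓ / 2 * (1 - a ^ 2))) (-(n + 1)) 0
    (-(ℓ / 2 * a)) (ℓ / 2 * (Φ n).eval 0)
    (-(ℓ / 2 * (1 - a ^ 2) * a)) (ℓ / 2 * (1 - a ^ 2) * (Φ (n + 2)).eval 0)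
    (-(ℓ / 2 * a ^ 2)) 0 (ℓ / 2)
    (-(ℓ ^ 2 / 4) + (n + 1) - secondOrderConst ℓ Φ n) (-(ℓ * (n + 1) / 2))
    (fun w hw => by linear_combination e2 hw)
    (fun w hw => by linear_combination e1 hw)
    (fun w => by rw [secondOrderConst, ← ha]; linear_combination w * ℓ / 2 * a * hp) z hz
  constructor
  · linear_combination h1
  · linear_combination h2

end IsMonicOPUC

end ModifiedBessel

end

/-! ### Assembly of the main theorem. -/

open ModifiedBessel Polynomial in
theorem mainTheorem8 (ℓ : ℝ) (hℓ : 0 < ℓ) (Φ : ℕ → ℂ[X]) (κ : ℕ → ℝ)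
    (hΦ : IsMonicOPUC (weight ℓ) Φ κ)
    (α : ℤ → ℂ) (hα : α = verblunsky Φ) (b : ℕ → ℂ) (hb : b = bCoeff κ)
    (n : ℕ) (hn : 1 ≤ n) :
    -- the Verblunsky coefficients are real
    (∀ k : ℤ, -1 ≤ k → (α k).im = 0) ∧
    -- `G_n`, `G_{n-1}^*` are holomorphic off the unit circle and `Y_n` is invertible there
    DifferentiableOn ℂ (G (weight ℓ) Φ n) (Metric.sphere 0 1)ᶜ ∧
    DifferentiableOn ℂ (GStar (weight ℓ) Φ (n - 1)) (Metric.sphere 0 1)ᶜ ∧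
    (∀ z : ℂ, z ∉ Metric.sphere (0 : ℂ) 1 → (Y (weight ℓ) Φ κ n z).det = 1) ∧
    -- the structure matrix, and the first and second order matrix equations for `Y_n`
    (∀ (U : Set ℂ) (ρ σ : ℂ → ℂ), U ⊆ (Metric.sphere 0 1 ∪ {0})ᶜ →
      IsBranchPair (weight ℓ) U ρ σ → ∀ z ∈ U,
        z ^ 2 • M (weight ℓ) Φ κ ρ σ n z = MTilde ℓ Φ κ n z ∧
        z ^ 2 • mderiv (Y (weight ℓ) Φ κ n) z =
          MTilde ℓ Φ κ n z * Y (weight ℓ) Φ κ n z -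
            z ^ 2 • (Y (weight ℓ) Φ κ n z * mderiv (CMat ρ σ n) z * (CMat ρ σ n z)⁻¹) ∧
        z ^ 2 • mderiv (mderiv (Y (weight ℓ) Φ κ n)) z +
            2 • (mderiv (Y (weight ℓ) Φ κ n) z *
              (z ^ 2 • (mderiv (CMat ρ σ n) z * (CMat ρ σ n z)⁻¹) + z • 1)) +
            Y (weight ℓ) Φ κ n z *
              (z ^ 2 • (mderiv (mderiv (CMat ρ σ n)) z * (CMat ρ σ n z)⁻¹) +
                (2 * z) • (mderiv (CMat ρ σ n) z * (CMat ρ σ n z)⁻¹)) =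
          (mderiv (MTilde ℓ Φ κ n) z + (z ^ 2)⁻¹ • MTilde ℓ Φ κ n z ^ 2) *
            Y (weight ℓ) Φ κ n z) ∧
    -- first order relations
    (∀ z : ℂ,
      z ^ 2 * (derivative (Φ n)).eval z =
        (n * z + ℓ / 2 - ℓ / 2 * α (n - 1) ^ 2) * (Φ n).eval z +
          ℓ / 2 * b (n - 1) * (b n)⁻¹ * (α (n - 1) - α n * z) *
            (reciprocal Φ (n - 1)).eval z) ∧
    (∀ z : ℂ, z ∉ Metric.sphere (0 : ℂ) 1 →
      z ^ 2 * deriv (G (weight ℓ) Φ n) z =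
        (ℓ / 2 * z ^ 2 - ℓ / 2 * α (n - 1) ^ 2) * G (weight ℓ) Φ n z +
          ℓ / 2 * b (n - 1) * (b n)⁻¹ * (α (n - 1) - α n * z) *
            GStar (weight ℓ) Φ (n - 1) z) ∧
    (∀ z : ℂ,
      z ^ 2 * (derivative (reciprocal Φ (n - 1))).eval z =
        ℓ / 2 * (α (n - 1) - α (n - 2) * z) * (Φ n).eval z +
          (-(ℓ / 2) * z ^ 2 + ℓ / 2 * α (n - 1) ^ 2) * (reciprocal Φ (n - 1)).eval z) ∧
    (∀ z : ℂ, z ∉ Metric.sphere (0 : ℂ) 1 →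
      z ^ 2 * deriv (GStar (weight ℓ) Φ (n - 1)) z =
        ℓ / 2 * (α (n - 1) - α (n - 2) * z) * G (weight ℓ) Φ n z +
          (-(n * z) - ℓ / 2 + ℓ / 2 * α (n - 1) ^ 2) * GStar (weight ℓ) Φ (n - 1) z) ∧
    -- second order relations
    (∀ z : ℂ,
      z ^ 2 * (derivative (derivative (Φ n))).eval z +
          (ℓ / 2 * z ^ 2 + (2 - n) * z - ℓ / 2) * (derivative (Φ n)).eval z +
          (-(ℓ * n / 2 * z) - ℓ ^ 2 / 4 - n -
            ℓ ^ 2 / 4 * ((1 - α (n - 1) ^ 2) * α n * α (n - 2) - α (n - 1) ^ 2)) *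
              (Φ n).eval z =
        -(ℓ / 2) * (1 - α (n - 1) ^ 2) * α n * (reciprocal Φ (n - 1)).eval z) ∧
    (∀ z : ℂ, z ∉ Metric.sphere (0 : ℂ) 1 →
      z ^ 2 * deriv (deriv (G (weight ℓ) Φ n)) z +
          (-(ℓ / 2 * z ^ 2) + (n + 2) * z + ℓ / 2) * deriv (G (weight ℓ) Φ n) z -
          (ℓ * (n / 2 + 1) * z + ℓ ^ 2 / 4 +
            ℓ ^ 2 / 4 * ((1 - α (n - 1) ^ 2) * α n * α (n - 2) - α (n - 1) ^ 2)) *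
              G (weight ℓ) Φ n z =
        -(ℓ / 2) * (1 - α (n - 1) ^ 2) * α n * GStar (weight ℓ) Φ (n - 1) z) ∧
    (∀ z : ℂ,
      z ^ 2 * (derivative (derivative (reciprocal Φ (n - 1)))).eval z +
          (ℓ / 2 * z ^ 2 + (2 - n) * z - ℓ / 2) * (derivative (reciprocal Φ (n - 1))).eval z -
          (ℓ * (n / 2 - 1) * z + ℓ ^ 2 / 4 +
            ℓ ^ 2 / 4 * ((1 - α (n - 1) ^ 2) * α n * α (n - 2) - α (n - 1) ^ 2)) *
              (reciprocal Φ (n - 1)).eval z =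
        -(ℓ / 2) * α (n - 2) * (Φ n).eval z) ∧
    (∀ z : ℂ, z ∉ Metric.sphere (0 : ℂ) 1 →
      z ^ 2 * deriv (deriv (GStar (weight ℓ) Φ (n - 1))) z +
          (-(ℓ / 2 * z ^ 2) + (n + 2) * z + ℓ / 2) * deriv (GStar (weight ℓ) Φ (n - 1)) z -
          (ℓ * n / 2 * z + ℓ ^ 2 / 4 - n +
            ℓ ^ 2 / 4 * ((1 - α (n - 1) ^ 2) * α n * α (n - 2) - α (n - 1) ^ 2)) *
              GStar (weight ℓ) Φ (n - 1) z =
        -(ℓ / 2) * α (n - 2) * G (weight ℓ) Φ n z) := by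
  subst hα hb
  obtain ⟨n, rfl⟩ : ∃ m, n = m + 1 := ⟨n - 1, by omega⟩
  have hα₁ := hΦ.verblunsky_eq (k := ((n + 1 : ℕ) : ℤ) - 1) (m := n + 1) (by push_cast; ring)
  have hα₂ := hΦ.verblunsky_eq (k := ((n + 1 : ℕ) : ℤ)) (m := n + 2) (by push_cast; ring)
  -- After the shift, `α_{n-2}` is `-Φ_n(0)`. For shifted index `n = 0` this is the convention
  -- `α_{-1} = -1`, so no separate case is needed.
  have hα₀ := hΦ.verblunsky_eq (k := ((n + 1 : ℕ) : ℤ) - 2) (m := n) (by push_cast; ring)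
  have hr := hΦ.bCoeff_ratio n
  simp only [hα₀, hα₁, hα₂, Nat.add_sub_cancel]
  refine ⟨fun k _ => hΦ.im_verblunsky k,
    differentiableOn_cauchyTransform ℓ (n + 1) (Φ (n + 1)),
    differentiableOn_cauchyTransform ℓ (n + 1) (reciprocal Φ n), fun z hz => hΦ.det_Y n hz,
    fun U ρ σ hU h z hz => hΦ.matrix_system n hU h hz, fun z => ?_, fun z hz => ?_, fun z => ?_,
    fun z hz => ?_, fun z => ?_, fun z hz => ?_, fun z => ?_, fun z hz => ?_⟩
  · have h := congrArg (eval z) (hΦ.sq_mul_derivative n)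
    simp only [eval_mul, eval_add, eval_sub, eval_pow, eval_X, eval_C] at h
    push_cast
    linear_combination h - ℓ / 2 * ((Φ (n + 2)).eval 0 * z - (Φ (n + 1)).eval 0) *
      (reciprocal Φ n).eval z * hr
  · linear_combination hΦ.sq_mul_deriv_G n hz - ℓ / 2 * ((Φ (n + 2)).eval 0 * z -
      (Φ (n + 1)).eval 0) * GStar (weight ℓ) Φ n z * hr
  · have h := congrArg (eval z) (hΦ.sq_mul_derivative_reciprocal n)
    simp only [eval_mul, eval_add, eval_sub, eval_pow, eval_X, eval_C] at h
    linear_combination h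
  · push_cast
    linear_combination hΦ.sq_mul_deriv_GStar n hz
  · have h := (hΦ.second_order_polynomial n z).1
    rw [IsMonicOPUC.secondOrderConst] at h
    push_cast
    linear_combination h
  · have h := (hΦ.second_order_G n hz).1
    rw [IsMonicOPUC.secondOrderConst] at h
    push_cast
    linear_combination h
  · have h := (hΦ.second_order_polynomial n z).2
    rw [IsMonicOPUC.secondOrderConst] at h
    push_cast
    linear_combination h
  · have h := (hΦ.second_order_G n hz).2
    rw [IsMonicOPUC.secondOrderConst] at h
    push_cast
    linear_combination h
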